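/- **The model.** Let $n$ and $C\ge 1$ be integers and $\lambda>0$. Consider the complete graph on $V_n=\{1,\dots,n\}$, each of whose links has capacity $C$. For each pair $\{u,v\}$ of distinct nodes, calls with endpoints $u,v$ arrive as a Poisson process of rate $\lambda$, independently for different pairs (so the total rate is $\lambda\binom n2$ and the endpoints are uniform). A call with endpoints $u,v$ is routed over the direct link $\{u,v\}$ if fewer than $C$ calls currently use that link. Otherwise one node $w\in V_n\setminus\{u,v\}$ is chosen uniformly at random (the case $d=1$), and the call is routed along the two links $\{u,w\},\{v,w\}$ if each of them is used by fewer than $C$ calls; if not, the call is lost. A call in progress occupies one unit of capacity of each link on its route. Call durations are exponential with mean $1$; durations, arrivals and choices are independent. A load vector $x$ records the number $x(\{u,v\},0)$ of directly routed calls in progress between $u$ and $v$ and the number $x(\{u,v\},w)$ of calls in progress between $u$ and $v$ routed via $w$. The load of a link is $$x(\{u,v\})=x(\{u,v\},0)+\sum_{w\ne u,v}\big(x(\{u,w\},v)+x(\{v,w\},u)\big),$$ and the states are the load vectors in which every link has load at most $C$. Let $X=(X_t)_{t\ge0}$ be the resulting continuous-time Markov chain, with right-continuous paths, on the states. **Notation.**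 Let $\|x\|_1$ be the total number of calls in progress in $x$, let $f_{v,k}(x)$ be the number of links at node $v$ with load exactly $k$, and let $\mathbb I^j_{uv}(x)$ be $1$ if $u\neq v$ and $x(\{u,v\})=j$, and $0$ otherwise. Put $\phi=\max\{\phi^1,\phi^2,\phi^3\}$, where, with maxima over distinct nodes $u,v$ and over $j,k\in\{0,\dots,C\}$, $$\phi^1(x)=\max_{u,v,j,k}\Big|\frac1{n-2}\sum_{w}\mathbb I^j_{uw}(x)\mathbb I^k_{vw}(x)-\frac1{(n-2)^2}\sum_{w\ne u,v}\mathbb I^j_{uw}(x)\sum_{w'\ne u,v}\mathbb I^k_{vw'}(x)\Big|,$$ $$\phi^2(x)=\max_{u,v,j}\frac{1}{n-2}\big|f_{u,j}(x)-f_{v,j}(x)\big|,\qquad \phi^3(x)=\max_{u,v}\frac1{n-2}\sum_{w\ne u,v}x(\{u,v\},w).$$ Define $F:\mathbb R^{C+1}\to\mathbb R^{C+1}$, with $g_j(\xi)=2\xi(C)(1-\xi(C))\xi(j)$ for $0\le j\le C-1$, by $$F_0(\xi)=-\lambda\xi(0)-\lambda g_0(\xi)+\xi(1),$$ $$F_k(\xi)=\lambda\xi(k-1)-\lambda\xi(k)+\lambda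 g_{k-1}(\xi)-\lambda g_k(\xi)-k\xi(k)+(k+1)\xi(k+1)\quad(0<k<C),$$ $$F_C(\xi)=\lambda\xi(C-1)+\lambda g_{C-1}(\xi)-C\xi(C).$$ **Theorem 1.2.** Let $\lambda,t_0>0$ be real and let $C\ge1$ be an integer. Set $$\gamma=\frac{1}{2^{25}(1+C/\lambda)(8\lambda t_0+1)^3e^{800\lambda t_0}},$$ and suppose that $$n\ge\max\Big(2^{18}(\lambda+1/\lambda)^4(C+1)^6(t_0+1/t_0)^2,\ e^{8/\gamma}\Big).$$ Let $\xi_0\in\mathbb R^{C+1}$ have non-negative entries with $\sum_{k=0}^C\xi_0(k)=1$, and suppose that $\|X_0\|_1\le2\lambda\binom n2$ almost surely. Then the differential equation $d\xi_t/dt=F(\xi_t)$ with initial value $\xi_0$ has a unique solution $(\xi_t)$ on $[0,t_0]$. Moreover, let $B_n$ be the event that, for all $v\in V_n$, $k\in\{0,\dots,C\}$ and $t\in[0,t_0]$, $$|f_{v,k}(X_t)-(n-1)\xi_t(k)|\le\Big(\sup_{u,j}\big|f_{u,j}(X_0)-(n-1)\xi_0(j)\big|+64(\lambda+1)(t_0+1)(C+1)^3\big(n\phi(X_0)+3n^{1/2}\log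 n\big)\Big)e^{216(\lambda+1)(C+1)t_0},$$ where the supremum is over $u\in V_n$ and $j\in\{0,\dots,C\}$. Then $\mathbb P(\overline{B_n})\le e^{-\frac12\gamma\log^2n}$. -/

import Mathlib

open Set Filter Topology MeasureTheory
open scoped NNReal ENNReal

namespace Routing

noncomputable section

/-- A route in the complete graph on the node set `Fin n`, for a call whose endpoints are the two
elements of `ends`: the direct link if `mid = none`, and the two-link path through `w` if
`mid = some w`. A link is an off-diagonal element of `Sym2 (Fin n)`. -/
@[ext] structure Route (n : ℕ) where
  ends : Sym2 (Fin n)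
  mid : Option (Fin n)
  ends_ne : ¬ ends.IsDiag
  mid_ne : ∀ w ∈ mid, w ∉ ends

instance (n : ℕ) : Finite (Route n) :=
  Finite.of_injective (fun r : Route n => (r.ends, r.mid)) fun _ _ h =>
    Route.ext (congrArg Prod.fst h) (congrArg Prod.snd h)

instance (n : ℕ) : Fintype (Route n) := Fintype.ofFinite _

/-- The route `r` occupies the link `e`. -/
def Route.Uses {n : ℕ} (r : Route n) (e : Sym2 (Fin n)) : Prop :=
  match r.mid with
  | none => e = r.ends
  | some w => ∃ a ∈ r.ends, e = s(a, w)

lemma Route.exists_uses {n : ℕ} (r : Route n) : ∃ e, r.Uses e := by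
  obtain ⟨e, m, he, hm⟩ := r
  cases m with
  | none => exact ⟨e, rfl⟩
  | some w =>
    induction e using Sym2.ind with
    | _ a b => exact ⟨s(a, w), a, Sym2.mem_mk_left a b, rfl⟩

open scoped Classical in
/-- A load vector `x` gives the number `x r` of calls in progress on each route `r`. The load of
the link `e` is the number of calls in progress whose route occupies `e`. -/
def linkLoad {n : ℕ} (x : Route n → ℕ) (e : Sym2 (Fin n)) : ℕ :=
  ∑ r with r.Uses e, x r

/-- The states of the network: load vectors that respect the capacity `C` of each link. -/
def State (n C : ℕ) : Type := {x : Route n → ℕ // ∀ e, linkLoad x e ≤ C}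

lemma State.le {n C : ℕ} (x : State n C) (r : Route n) : x.1 r ≤ C := by
  classical
  obtain ⟨e, he⟩ := r.exists_uses
  refine le_trans ?_ (x.2 e)
  unfold linkLoad
  exact Finset.single_le_sum (f := x.1) (fun _ _ => Nat.zero_le _) (by simp [he])

instance (n C : ℕ) : Finite (State n C) :=
  Finite.of_injective
    (fun (x : State n C) (r : Route n) => (⟨x.1 r, Nat.lt_succ_of_le (x.le r)⟩ : Fin (C + 1)))
    fun _ _ h => Subtype.ext (funext fun r => congrArg Fin.val (congrFun h r))

instance (n C : ℕ) : Fintype (State n C) := Fintype.ofFinite _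

instance (n C : ℕ) : DecidableEq (State n C) := Classical.decEq _

open scoped Classical in
/-- The rate at which calls join the route `r` in state `x`. Calls arrive at total rate
`lam * n.choose 2` with uniform endpoints, so at rate `lam` for each pair of endpoints. A call takes
its direct link if that link is not full. Otherwise one of the `n - 2` possible intermediate nodes
is chosen uniformly, and the call takes the two-link route through it if neither of its links is
full; if one of them is full, then the call is lost. -/
def arrivalRate {n : ℕ} (lam : ℝ) (C : ℕ) (x : Route n → ℕ) (r : Route n) : ℝ :=
  match r.mid with
  | none => if linkLoad x r.ends < C then lam else 0
  | some _ =>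
    if C ≤ linkLoad x r.ends ∧ ∀ e, r.Uses e → linkLoad x e < C then lam / ((n : ℝ) - 2) else 0

open scoped Classical in
/-- The rate of jumps from `x` to `y`. Call durations are exponential with mean one, so that a call
leaves the route `r` at rate `x r`. -/
def jumpRate {n C : ℕ} (lam : ℝ) (x y : State n C) : ℝ :=
  ∑ r : Route n,
    ((if y.1 = x.1 + Pi.single r 1 then arrivalRate lam C x.1 r else 0) +
      (if x.1 = y.1 + Pi.single r 1 then (x.1 r : ℝ) else 0))

/-- The generator matrix of the network. -/
def generator (n C : ℕ) (lam : ℝ) : Matrix (State n C) (State n C) ℝ :=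
  fun x y => if x = y then - ∑ z with z ≠ x, jumpRate lam x z else jumpRate lam x y

/-- `X` is a continuous-time Markov chain with right-continuous paths (for the discrete topology of
the state space) and transition probabilities `exp (t Q)`, where `Q` is the generator matrix of the
network. Its initial distribution is arbitrary. -/
structure IsRoutingProcess {Ω : Type*} [MeasurableSpace Ω] (P : Measure Ω) (n C : ℕ) (lam : ℝ)
    (X : ℝ≥0 → Ω → State n C) : Prop where
  measurable : ∀ t y, MeasurableSet {ω | X t ω = y}
  right_continuous : ∀ᵐ ω ∂P, ∀ t : ℝ≥0, ∀ᶠ s in 𝓝[≥] t, X s ω = X t ω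
  markov : ∀ (m : ℕ) (t : Fin (m + 1) → ℝ≥0), Monotone t → ∀ x : Fin (m + 1) → State n C,
    P.real {ω | ∀ i, X (t i) ω = x i} =
      P.real {ω | X (t 0) ω = x 0} *
        ∏ i : Fin m, NormedSpace.exp
          (((t i.succ : ℝ) - (t i.castSucc : ℝ)) • generator n C lam) (x i.castSucc) (x i.succ)

/-- The indicator that the link `{u, v}` has load `j`; it is zero if `u = v`. -/
def ind {n : ℕ} (x : Route n → ℕ) (u v : Fin n) (j : ℕ) : ℝ :=
  if u ≠ v ∧ linkLoad x s(u, v) = j then 1 else 0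

/-- The number of links at the node `v` with load exactly `k`. -/
def numLinks {n : ℕ} (x : Route n → ℕ) (v : Fin n) (k : ℕ) : ℕ :=
  Finset.card {w : Fin n | w ≠ v ∧ linkLoad x s(v, w) = k}

/-- Ordered pairs of distinct nodes. -/
abbrev Pairs (n : ℕ) : Type := {p : Fin n × Fin n // p.1 ≠ p.2}

def phi1 {n : ℕ} (C : ℕ) (x : Route n → ℕ) : ℝ :=
  ⨆ q : Pairs n × Fin (C + 1) × Fin (C + 1),
    let u := q.1.1.1
    let v := q.1.1.2
    |1 / ((n : ℝ) - 2) * ∑ w, ind x u w q.2.1 * ind x v w q.2.2 -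
      1 / ((n : ℝ) - 2) ^ 2 * ((∑ w with w ≠ u ∧ w ≠ v, ind x u w q.2.1) *
        ∑ w with w ≠ u ∧ w ≠ v, ind x v w q.2.2)|

def phi2 {n : ℕ} (C : ℕ) (x : Route n → ℕ) : ℝ :=
  ⨆ q : Pairs n × Fin (C + 1),
    1 / ((n : ℝ) - 2) * |(numLinks x q.1.1.1 q.2 : ℝ) - numLinks x q.1.1.2 q.2|

/-- The largest number, divided by `n - 2`, of indirectly routed calls with given endpoints. -/
def phi3 {n : ℕ} (x : Route n → ℕ) : ℝ :=
  ⨆ q : Pairs n,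
    1 / ((n : ℝ) - 2) * ((∑ r : Route n with r.ends = s(q.1.1, q.1.2) ∧ r.mid ≠ none, x r : ℕ) : ℝ)

def phi {n : ℕ} (C : ℕ) (x : Route n → ℕ) : ℝ := max (phi1 C x) (max (phi2 C x) (phi3 x))

/-- `2 ξ(C) (1 - ξ(C)) ξ(j)`. -/
def altRate {C : ℕ} (ξ : Fin (C + 1) → ℝ) (j : Fin (C + 1)) : ℝ :=
  2 * ξ (Fin.last C) * (1 - ξ (Fin.last C)) * ξ j

/-- The vector field of the limiting differential equation. -/
def drift (C : ℕ) (lam : ℝ) (ξ : Fin (C + 1) → ℝ) (k : Fin (C + 1)) : ℝ :=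
  (if 0 < (k : ℕ) then
      lam * ξ ⟨k - 1, by omega⟩ + lam * altRate ξ ⟨k - 1, by omega⟩
    else 0) +
  (if h : (k : ℕ) < C then
      -(lam * ξ k) - lam * altRate ξ k + ((k : ℝ) + 1) * ξ ⟨k + 1, by omega⟩
    else 0) -
  (k : ℝ) * ξ k

/-- `ξ` solves `dξ/dt = F(ξ)` on `[0, t₀]` with initial value `ξ₀`. -/
def IsSolution (C : ℕ) (lam t₀ : ℝ) (ξ₀ : Fin (C + 1) → ℝ) (ξ : ℝ → Fin (C + 1) → ℝ) : Prop :=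
  ξ 0 = ξ₀ ∧ ∀ t ∈ Icc 0 t₀, HasDerivWithinAt ξ (drift C lam (ξ t)) (Icc 0 t₀) t

/-- The constant `γ`. -/
def gam (lam : ℝ) (C : ℕ) (t₀ : ℝ) : ℝ :=
  1 / (2 ^ 25 * (1 + C / lam) * (8 * lam * t₀ + 1) ^ 3 * Real.exp (800 * lam * t₀))

/-- The error bound, for the initial state `x`. -/
def errorBound {n : ℕ} (lam : ℝ) (C : ℕ) (t₀ : ℝ) (ξ₀ : Fin (C + 1) → ℝ) (x : Route n → ℕ) : ℝ :=
  ((⨆ p : Fin n × Fin (C + 1), |(numLinks x p.1 p.2 : ℝ) - ((n : ℝ) - 1) * ξ₀ p.2|) +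
      64 * (lam + 1) * (t₀ + 1) * ((C : ℝ) + 1) ^ 3 *
        (n * phi C x + 3 * (n : ℝ) ^ (1 / 2 : ℝ) * Real.log n)) *
    Real.exp (216 * (lam + 1) * ((C : ℝ) + 1) * t₀)

end

end Routing

/-!
The number of links with a given load at a node, the number of pairs of links with given loads
that join a common neighbour to two nodes, and the number of indirectly routed calls between two
nodes change by a bounded amount at each jump of a finite Markov chain. On a fine time grid, an
exponential supermartingale bound therefore keeps each of these statistics within `√n log n` of
its initial value plus its accumulated drift, outside an event of probability at most `exp (-½ γ
log² n)`. Up to the deviation of the statistics from the values that a profile `ζ` of load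
proportions prescribes, and an error of constant order, the drift of the statistics is that
prescribed by `F ζ`; by a discrete Gronwall inequality they stay close to the solution of the
differential equation along the grid. Right continuity of the paths carries the bound from finer
and finer grids to `[0, t₀]`.
-/

namespace Routing

noncomputable section

section FiniteMarkovChains

variable {S : Type*}

/-- The transition weight of a path: the probability that a Markov chain with transition matrix `p`
started at `y 0` follows `y`. -/
def pathWeight (p : Matrix S S ℝ) {N : ℕ} (y : Fin (N + 1) → S) : ℝ :=
  ∏ i : Fin N, p (y i.castSucc) (y i.succ)

/-- The probability that the first `N` steps of the Markov chain with transition matrix `p` started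
at `x` form a path in `B`. -/
def pathProb [Fintype S] (p : Matrix S S ℝ) (x : S) {N : ℕ} (B : Set (Fin (N + 1) → S)) : ℝ :=
  ∑ z : Fin N → S, B.indicator (pathWeight p) (Fin.cons x z)

/-- The paths along which `g`, minus its compensator with increments `c`, at some time exceeds its
initial value by at least `a`. -/
def exceedance (g c : S → ℝ) (a : ℝ) (N : ℕ) : Set (Fin (N + 1) → S) :=
  {y | ∃ i, a ≤ g (y i) - g (y 0) - ∑ l ∈ Finset.Iio i, c (y l)}

lemma pathWeight_cons (p : Matrix S S ℝ) {N : ℕ} (x : S) (y : Fin (N + 1) → S) :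
    pathWeight p (Fin.cons x y : Fin (N + 2) → S) = p x (y 0) * pathWeight p y := by
  simp [pathWeight, Fin.prod_univ_succ]

lemma sum_fin_succ_pi [Fintype S] {N : ℕ} (f : (Fin (N + 1) → S) → ℝ) :
    ∑ y, f y = ∑ x, ∑ z : Fin N → S, f (Fin.cons x z) := by
  rw [← (Fin.consEquiv fun _ => S).sum_comp, Fintype.sum_prod_type]
  rfl

lemma cons_mem_exceedance {g c : S → ℝ} {a : ℝ} {N : ℕ} {x : S} {y : Fin (N + 1) → S} (ha : 0 < a)
    (h : (Fin.cons x y : Fin (N + 2) → S) ∈ exceedance g c a (N + 1)) :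
    y ∈ exceedance g c (a - (g (y 0) - g x - c x)) N := by
  obtain ⟨i, hi⟩ := h
  induction i using Fin.cases with
  | zero =>
    rw [sub_self, zero_sub] at hi
    simp only [← Finset.filter_gt_eq_Iio, not_lt_zero, Finset.filter_false, Finset.sum_empty,
      neg_zero] at hi
    linarith
  | succ i =>
    refine ⟨i, ?_⟩
    simp only [← Finset.filter_gt_eq_Iio, Finset.sum_filter] at hi ⊢
    rw [Fin.sum_univ_succ] at hi
    simp only [Fin.cons_succ, Fin.cons_zero, Fin.succ_pos, if_true, Fin.succ_lt_succ_iff] at hi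
    linarith

lemma exceedance_subset_add_const {g c : S → ℝ} {a δ : ℝ} (hδ : 0 ≤ δ) (N : ℕ) :
    exceedance g c a N ⊆ exceedance g (fun x => c x + δ) (a - N * δ) N := by
  rintro y ⟨i, hi⟩
  refine ⟨i, ?_⟩
  have hiN : (i : ℝ) * δ ≤ N * δ := by gcongr; exact Nat.lt_succ_iff.1 i.2
  rw [Finset.sum_add_distrib, Finset.sum_const, Fin.card_Iio, nsmul_eq_mul]
  linarith

variable [Fintype S]

section PathProb

variable [DecidableEq S] {p : Matrix S S ℝ}

lemma pathWeight_nonneg (hp : p ∈ Matrix.rowStochastic ℝ S) {N : ℕ} (y : Fin (N + 1) → S) :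
    0 ≤ pathWeight p y :=
  Finset.prod_nonneg fun _ _ => Matrix.nonneg_of_mem_rowStochastic hp

lemma pathProb_mono (hp : p ∈ Matrix.rowStochastic ℝ S) (x : S) {N : ℕ}
    {A B : Set (Fin (N + 1) → S)} (h : ∀ z, Fin.cons x z ∈ A → Fin.cons x z ∈ B) :
    pathProb p x A ≤ pathProb p x B := by
  refine Finset.sum_le_sum fun z _ => ?_
  by_cases hz : (Fin.cons x z : Fin (N + 1) → S) ∈ A
  · rw [indicator_of_mem hz, indicator_of_mem (h z hz)]
  · rw [indicator_of_notMem hz]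
    exact indicator_nonneg (fun y _ => pathWeight_nonneg hp y) _

omit [DecidableEq S] in
lemma pathProb_succ (x : S) {N : ℕ} (B : Set (Fin (N + 2) → S)) :
    pathProb p x B =
      ∑ y, p x y * pathProb p y {z | (Fin.cons x z : Fin (N + 2) → S) ∈ B} := by
  simp only [pathProb]
  rw [sum_fin_succ_pi]
  refine Finset.sum_congr rfl fun y _ => ?_
  rw [Finset.mul_sum]
  refine Finset.sum_congr rfl fun z _ => ?_
  by_cases hz : (Fin.cons x (Fin.cons y z : Fin (N + 1) → S) : Fin (N + 2) → S) ∈ B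
  · rw [indicator_of_mem hz, indicator_of_mem (by exact hz), pathWeight_cons, Fin.cons_zero]
  · rw [indicator_of_notMem hz, indicator_of_notMem (by exact hz), mul_zero]

lemma pathProb_le_one (hp : p ∈ Matrix.rowStochastic ℝ S) (x : S) {N : ℕ}
    (B : Set (Fin (N + 1) → S)) : pathProb p x B ≤ 1 := by
  refine (pathProb_mono hp x fun z _ => mem_univ _).trans_eq ?_
  clear B
  induction N generalizing x with
  | zero => simp [pathProb, pathWeight]
  | succ N ih =>
    simp only [pathProb_succ, mem_univ, ofPred_true, ih, mul_one]
    exact Matrix.sum_row_of_mem_rowStochastic hp x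

/-- A maximal inequality for the supermartingale `exp (g - g 0 - ∑ c)`, by conditioning on the
first step. -/
lemma pathProb_exceedance_le (hp : p ∈ Matrix.rowStochastic ℝ S) {g c : S → ℝ}
    (hgc : ∀ x, ∑ y, p x y * Real.exp (g y - g x - c x) ≤ 1) (N : ℕ) (a : ℝ) (x : S) :
    pathProb p x (exceedance g c a N) ≤ Real.exp (-a) := by
  induction N generalizing a x with
  | zero =>
    rcases le_or_gt a 0 with ha | ha
    · exact (pathProb_le_one hp x _).trans (Real.one_le_exp (by linarith))
    · have hempty : exceedance g c a 0 = ∅ := by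
        refine eq_empty_of_forall_notMem fun y hy => ?_
        obtain ⟨i, hi⟩ := hy
        obtain rfl : i = 0 := by omega
        simp only [sub_self, ← Finset.filter_gt_eq_Iio, not_lt_zero,
          Finset.filter_false, Finset.sum_empty] at hi
        linarith
      simp only [hempty, pathProb, indicator_empty, Finset.sum_const_zero]
      exact Real.exp_nonneg _
  | succ N ih =>
    rcases le_or_gt a 0 with ha | ha
    · exact (pathProb_le_one hp x _).trans (Real.one_le_exp (by linarith))
    · rw [pathProb_succ]
      calc ∑ y, p x y * pathProb p y {z | Fin.cons x z ∈ exceedance g c a (N + 1)}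
          ≤ ∑ y, p x y * pathProb p y (exceedance g c (a - (g y - g x - c x)) N) := by
            gcongr with y
            · exact Matrix.nonneg_of_mem_rowStochastic hp
            · exact pathProb_mono hp y fun z hz => cons_mem_exceedance ha hz
        _ ≤ ∑ y, p x y * Real.exp (-(a - (g y - g x - c x))) := by
            gcongr with y
            · exact Matrix.nonneg_of_mem_rowStochastic hp
            · exact ih _ _
        _ = Real.exp (-a) * ∑ y, p x y * Real.exp (g y - g x - c x) := by
            rw [Finset.mul_sum]
            refine Finset.sum_congr rfl fun y _ => ?_
            rw [mul_left_comm, ← Real.exp_add]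
            ring_nf
        _ ≤ Real.exp (-a) := mul_le_of_le_one_right (Real.exp_nonneg _) (hgc x)

end PathProb

lemma measureReal_mem_le_of_pathProb_le {Ω : Type*} [MeasurableSpace Ω] {P : Measure Ω}
    [IsProbabilityMeasure P] {p : Matrix S S ℝ} {N : ℕ} {Y : Ω → Fin (N + 1) → S}
    (hmeas : ∀ x, MeasurableSet {ω | Y ω 0 = x})
    (hY : ∀ y : Fin (N + 1) → S, P.real {ω | Y ω = y} = P.real {ω | Y ω 0 = y 0} * pathWeight p y)
    {B : Set (Fin (N + 1) → S)} {b : ℝ} (hB : ∀ x, pathProb p x B ≤ b) :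
    P.real {ω | Y ω ∈ B} ≤ b := by
  classical
  have hone : ∑ x, P.real {ω | Y ω 0 = x} = 1 := by
    have hdisj : ((Finset.univ : Finset S) : Set S).PairwiseDisjoint fun x => {ω | Y ω 0 = x} :=
      fun x _ y _ hxy => Set.disjoint_left.2 fun ω (h1 : _ = _) (h2 : _ = _) =>
        hxy (h1.symm.trans h2)
    rw [← measureReal_biUnion_finset hdisj fun x _ => hmeas x, ← probReal_univ (μ := P)]
    congr 1
    ext ω
    simp
  have hsub : {ω | Y ω ∈ B} ⊆ ⋃ y ∈ Finset.univ.filter (· ∈ B), {ω | Y ω = y} :=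
    fun ω hω => by simpa using hω
  calc P.real {ω | Y ω ∈ B}
      ≤ P.real (⋃ y ∈ Finset.univ.filter (· ∈ B), {ω | Y ω = y}) :=
        measureReal_mono hsub (measure_ne_top _ _)
    _ ≤ ∑ y ∈ Finset.univ.filter (· ∈ B), P.real {ω | Y ω = y} :=
        measureReal_biUnion_finset_le _ _
    _ = ∑ x, P.real {ω | Y ω 0 = x} * pathProb p x B := by
        simp only [pathProb, Finset.sum_filter, sum_fin_succ_pi, Finset.mul_sum, indicator_apply,
          mul_ite, mul_zero, hY, Fin.cons_zero]
    _ ≤ ∑ x, P.real {ω | Y ω 0 = x} * b := by gcongr with x; exact hB x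
    _ = b := by rw [← Finset.sum_mul, hone, one_mul]

/-- The generator matrices of continuous-time Markov chains on a finite state space. -/
structure IsQMatrix (Q : Matrix S S ℝ) : Prop where
  nonneg : ∀ ⦃x y⦄, x ≠ y → 0 ≤ Q x y
  sum_row : ∀ x, ∑ y, Q x y = 0

lemma IsQMatrix.mulVec_apply {Q : Matrix S S ℝ} (hQ : IsQMatrix Q) (g : S → ℝ) (x : S) :
    (Q.mulVec g) x = ∑ y, Q x y * (g y - g x) := by
  simp only [Matrix.mulVec, dotProduct, mul_sub, Finset.sum_sub_distrib, ← Finset.sum_mul,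
    hQ.sum_row, zero_mul, sub_zero]

variable [DecidableEq S]

lemma hasSum_exp_smul_apply (s : ℝ) (A : Matrix S S ℝ) (x y : S) :
    HasSum (fun k : ℕ => (k.factorial : ℝ)⁻¹ * s ^ k * (A ^ k) x y)
      (NormedSpace.exp (s • A) x y) := by
  have h : HasSum (fun k : ℕ => (k.factorial : ℝ)⁻¹ • (s • A) ^ k) (NormedSpace.exp (s • A)) := by
    open scoped Matrix.Norms.Operator in
    exact NormedSpace.exp_series_hasSum_exp' (𝕂 := ℝ) (s • A)
  simpa [smul_pow, mul_assoc] using Pi.hasSum.1 (Pi.hasSum.1 h x) y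

lemma hasDerivAt_exp_smul_apply (A : Matrix S S ℝ) (x y : S) :
    HasDerivAt (fun t : ℝ => NormedSpace.exp (t • A) x y) (A x y) 0 := by
  open scoped Matrix.Norms.Operator in
  have h := hasDerivAt_exp_smul_const (𝕂 := ℝ) A (0 : ℝ)
  have h2 := ((LinearMap.toContinuousLinearMap
    (Matrix.entryLinearMap ℝ ℝ x y)).hasFDerivAt.comp_hasDerivAt (0 : ℝ) h)
  simp only [zero_smul, NormedSpace.exp_zero, one_mul] at h2
  exact h2

lemma exp_smul_sub_one_mem_rowStochastic {p : Matrix S S ℝ} (hp : p ∈ Matrix.rowStochastic ℝ S)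
    {s : ℝ} (hs : 0 ≤ s) : NormedSpace.exp (s • (p - 1)) ∈ Matrix.rowStochastic ℝ S := by
  have hpk (k : ℕ) : p ^ k ∈ Matrix.rowStochastic ℝ S := pow_mem hp k
  have hexp : NormedSpace.exp (s • (p - 1)) = Real.exp (-s) • NormedSpace.exp (s • p) := by
    have hone : NormedSpace.exp ((-s) • (1 : Matrix S S ℝ)) = Real.exp (-s) • 1 := by
      rw [Matrix.smul_one_eq_diagonal, Matrix.exp_diagonal, Matrix.smul_one_eq_diagonal,
        Real.exp_eq_exp_ℝ]
      exact congrArg Matrix.diagonal (funext fun _ => Pi.coe_exp _ _)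
    rw [smul_sub, sub_eq_add_neg, ← neg_smul, Matrix.exp_add_of_commute _ _
      ((Commute.one_right _).smul_right _), hone, mul_smul_comm, mul_one]
  rw [hexp, Matrix.mem_rowStochastic_iff_sum]
  refine ⟨fun x y => mul_nonneg (Real.exp_nonneg _) ?_, fun x => ?_⟩
  · exact (hasSum_exp_smul_apply s p x y).nonneg fun k =>
      mul_nonneg (by positivity) (Matrix.nonneg_of_mem_rowStochastic (hpk k))
  · have hsum : HasSum (fun k : ℕ => (k.factorial : ℝ)⁻¹ * s ^ k)
        (∑ y, NormedSpace.exp (s • p) x y) := by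
      simpa only [← Finset.mul_sum, Matrix.sum_row_of_mem_rowStochastic (hpk _), mul_one] using
        hasSum_sum (s := Finset.univ) fun y _ => hasSum_exp_smul_apply s p x y
    have hreal : HasSum (fun k : ℕ => (k.factorial : ℝ)⁻¹ * s ^ k) (Real.exp s) := by
      rw [Real.exp_eq_exp_ℝ]
      exact NormedSpace.exp_series_hasSum_exp' (𝕂 := ℝ) s
    simp only [Matrix.smul_apply, smul_eq_mul, ← Finset.mul_sum, hsum.unique hreal]
    rw [← Real.exp_add, neg_add_cancel, Real.exp_zero]

/-- Uniformization: `Q = c (p - 1)` with `p` stochastic, for every large enough rate `c`. -/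
lemma IsQMatrix.exp_smul_mem_rowStochastic {Q : Matrix S S ℝ} (hQ : IsQMatrix Q) {t : ℝ}
    (ht : 0 ≤ t) : NormedSpace.exp (t • Q) ∈ Matrix.rowStochastic ℝ S := by
  obtain ⟨c, hc0, hc⟩ : ∃ c : ℝ, 0 < c ∧ ∀ x, -Q x x ≤ c := by
    refine ⟨1 + ∑ x, |Q x x|, by positivity, fun x => ?_⟩
    linarith [neg_le_abs (Q x x), Finset.single_le_sum (f := fun x => |Q x x|)
      (fun _ _ => abs_nonneg _) (Finset.mem_univ x)]
  have hp : 1 + c⁻¹ • Q ∈ Matrix.rowStochastic ℝ S := by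
    refine Matrix.mem_rowStochastic_iff_sum.2 ⟨fun x y => ?_, fun x => ?_⟩
    · simp only [Matrix.add_apply, Matrix.smul_apply, smul_eq_mul, Matrix.one_apply]
      split_ifs with hxy
      · subst hxy
        rw [← div_eq_inv_mul]
        linarith [(div_le_one hc0).2 (hc x), neg_div c (Q x x)]
      · rw [zero_add]
        exact mul_nonneg (inv_nonneg.2 hc0.le) (hQ.nonneg hxy)
    · simp [Finset.sum_add_distrib, Matrix.one_apply, ← Finset.mul_sum, hQ.sum_row]
  convert exp_smul_sub_one_mem_rowStochastic hp (mul_nonneg ht hc0.le) using 2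
  rw [add_sub_cancel_left, smul_smul, mul_assoc, mul_inv_cancel₀ hc0.ne', mul_one]

omit [DecidableEq S] in
lemma IsQMatrix.sum_mul_exp_sub_le {Q : Matrix S S ℝ} (hQ : IsQMatrix Q) {g : S → ℝ}
    (hg1 : ∀ x y, x ≠ y → Q x y ≠ 0 → |g y - g x| ≤ 1) (x : S) :
    ∑ y, Q x y * Real.exp (g y - g x) ≤ Q.mulVec g x + ∑ y, Q x y * (g y - g x) ^ 2 := by
  calc ∑ y, Q x y * Real.exp (g y - g x)
      = ∑ y, Q x y * (Real.exp (g y - g x) - 1) := by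
        simp only [mul_sub, Finset.sum_sub_distrib, mul_one, hQ.sum_row, sub_zero]
    _ ≤ ∑ y, (Q x y * (g y - g x) + Q x y * (g y - g x) ^ 2) := by
        refine Finset.sum_le_sum fun y _ => ?_
        by_cases hxy : x = y
        · simp [hxy]
        by_cases hq : Q x y = 0
        · simp [hq]
        have hexp := (abs_le.1 (Real.abs_exp_sub_one_sub_id_le (hg1 x y hxy hq))).2
        rw [← mul_add]
        exact mul_le_mul_of_nonneg_left (by linarith) (hQ.nonneg hxy)
    _ = Q.mulVec g x + ∑ y, Q x y * (g y - g x) ^ 2 := by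
        rw [Finset.sum_add_distrib, hQ.mulVec_apply]

lemma IsQMatrix.eventually_sum_exp_smul_mul_exp_le {Q : Matrix S S ℝ} (hQ : IsQMatrix Q)
    {g : S → ℝ} {V ε : ℝ} (hε : 0 < ε) (hg1 : ∀ x y, x ≠ y → Q x y ≠ 0 → |g y - g x| ≤ 1)
    (hgV : ∀ x, ∑ y, Q x y * (g y - g x) ^ 2 ≤ V) :
    ∀ᶠ h : ℝ in 𝓝[>] 0, ∀ x, ∑ y, NormedSpace.exp (h • Q) x y *
      Real.exp (g y - g x - (h * Q.mulVec g x + h * (V + ε))) ≤ 1 := by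
  refine eventually_all.2 fun x => ?_
  set φ : ℝ → ℝ := fun h => ∑ y, NormedSpace.exp (h • Q) x y * Real.exp (g y - g x) with hφ
  have hderiv : HasDerivAt φ (∑ y, Q x y * Real.exp (g y - g x)) 0 :=
    HasDerivAt.fun_sum fun y _ => (hasDerivAt_exp_smul_apply Q x y).mul_const _
  have hφ0 : φ 0 = 1 := by simp [hφ, Matrix.one_apply]
  have hslope := (hasDerivAt_iff_tendsto_slope.1 hderiv).eventually
    (gt_mem_nhds (lt_add_of_pos_right _ hε))
  filter_upwards [hslope.filter_mono (nhdsWithin_mono _ fun t (ht : 0 < t) => ht.ne'),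
    self_mem_nhdsWithin] with h hh (hpos : 0 < h)
  rw [slope_def_field, hφ0, sub_zero, div_lt_iff₀ hpos] at hh
  set D := Q.mulVec g x + (V + ε) with hD
  have hφh : φ h ≤ Real.exp (h * D) := by
    have hb := hQ.sum_mul_exp_sub_le hg1 x
    nlinarith [Real.add_one_le_exp (h * D), hgV x]
  calc ∑ y, NormedSpace.exp (h • Q) x y *
        Real.exp (g y - g x - (h * Q.mulVec g x + h * (V + ε)))
      = φ h * Real.exp (-(h * D)) := by
        rw [hφ, Finset.sum_mul]
        refine Finset.sum_congr rfl fun y _ => ?_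
        rw [mul_assoc, ← Real.exp_add, hD]
        ring_nf
    _ ≤ Real.exp (h * D) * Real.exp (-(h * D)) := by gcongr
    _ = 1 := by rw [← Real.exp_add, add_neg_cancel, Real.exp_zero]

/-- An exponential deviation inequality for the martingale part of `g`, with `V` bounding its
quadratic variation per unit of time, along the skeleton with mesh `h`. -/
lemma IsQMatrix.eventually_pathProb_exceedance_le {Q : Matrix S S ℝ} (hQ : IsQMatrix Q)
    {g : S → ℝ} {V ε : ℝ} (hε : 0 < ε) (hV : 0 ≤ V)
    (hg1 : ∀ x y, x ≠ y → Q x y ≠ 0 → |g y - g x| ≤ 1)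
    (hgV : ∀ x, ∑ y, Q x y * (g y - g x) ^ 2 ≤ V) :
    ∀ᶠ h : ℝ in 𝓝[>] 0, ∀ (N : ℕ) (a : ℝ) (x : S),
      pathProb (NormedSpace.exp (h • Q)) x (exceedance g (fun x => h * Q.mulVec g x) a N) ≤
        Real.exp (-a + N * h * (V + ε)) := by
  filter_upwards [hQ.eventually_sum_exp_smul_mul_exp_le hε hg1 hgV, self_mem_nhdsWithin]
    with h hh (hpos : 0 < h) N a x
  have hp := hQ.exp_smul_mem_rowStochastic hpos.le
  calc pathProb _ x (exceedance g (fun x => h * Q.mulVec g x) a N)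
      ≤ pathProb _ x (exceedance g (fun x => h * Q.mulVec g x + h * (V + ε))
          (a - N * (h * (V + ε))) N) :=
        pathProb_mono hp x fun z hz => exceedance_subset_add_const (by positivity) N hz
    _ ≤ Real.exp (-(a - N * (h * (V + ε)))) := pathProb_exceedance_le hp hh N _ x
    _ = Real.exp (-a + N * h * (V + ε)) := by ring_nf

end FiniteMarkovChains

section Generator

instance (n : ℕ) : DecidableEq (Route n) := fun _ _ => Classical.propDecidable _

instance {n : ℕ} (r : Route n) (e : Sym2 (Fin n)) : Decidable (r.Uses e) :=
  Classical.propDecidable _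

variable {n C : ℕ} {lam : ℝ}

lemma linkLoad_add_single (x : Route n → ℕ) (r : Route n) (e : Sym2 (Fin n)) :
    linkLoad (x + Pi.single r 1) e = linkLoad x e + if r.Uses e then 1 else 0 := by
  simp only [linkLoad, Pi.add_apply, Finset.sum_add_distrib]
  congr 1
  simp

lemma sub_single_add_single {x : Route n → ℕ} {r : Route n} (hr : x r ≠ 0) :
    x - Pi.single r 1 + Pi.single r 1 = x := by
  refine tsub_add_cancel_of_le fun s => ?_
  obtain rfl | h := eq_or_ne s r
  · simpa using Nat.one_le_iff_ne_zero.2 hr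
  · simp [h]

lemma linkLoad_sub_single {x : Route n → ℕ} {r : Route n} (hr : x r ≠ 0) (e : Sym2 (Fin n)) :
    linkLoad x e = linkLoad (x - Pi.single r 1) e + if r.Uses e then 1 else 0 := by
  rw [← linkLoad_add_single, sub_single_add_single hr]

lemma Route.two_lt_of_mid_eq_some {r : Route n} {w : Fin n} (h : r.mid = some w) : 2 < n := by
  obtain ⟨e, m, he, hm⟩ := r
  obtain rfl : m = some w := h
  induction e using Sym2.ind with
  | _ a b =>
    have hw : w ∉ s(a, b) := hm w rfl
    rw [Sym2.mem_iff, not_or] at hw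
    have hcard : ({w, a, b} : Finset (Fin n)).card = 3 :=
      Finset.card_eq_three.2 ⟨w, a, b, hw.1, hw.2, he, rfl⟩
    have := hcard.symm.trans_le (Finset.card_le_univ _)
    rwa [Fintype.card_fin] at this

lemma arrivalRate_nonneg (hlam : 0 ≤ lam) (x : Route n → ℕ) (r : Route n) :
    0 ≤ arrivalRate lam C x r := by
  unfold arrivalRate
  split
  · split_ifs <;> simp [hlam]
  · next w hw =>
    have hn : (2 : ℝ) < n := by exact_mod_cast Route.two_lt_of_mid_eq_some hw
    split_ifs
    · exact div_nonneg hlam (by linarith)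
    · exact le_rfl

lemma linkLoad_lt_of_arrivalRate_ne_zero {x : Route n → ℕ} {r : Route n}
    (h : arrivalRate lam C x r ≠ 0) {e : Sym2 (Fin n)} (he : r.Uses e) : linkLoad x e < C := by
  obtain ⟨ends, mid, h1, h2⟩ := r
  cases mid with
  | none =>
    obtain rfl : e = ends := he
    exact (ite_ne_right_iff.1 h).1
  | some w => exact (ite_ne_right_iff.1 h).1.2 e he

lemma linkLoad_add_single_le {x : State n C} {r : Route n} (h : arrivalRate lam C x.1 r ≠ 0)
    (e : Sym2 (Fin n)) : linkLoad (x.1 + Pi.single r 1) e ≤ C := by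
  rw [linkLoad_add_single]
  split_ifs with he
  · exact linkLoad_lt_of_arrivalRate_ne_zero h he
  · exact x.2 e

lemma linkLoad_sub_single_le (x : State n C) {r : Route n} (h : x.1 r ≠ 0)
    (e : Sym2 (Fin n)) : linkLoad (x.1 - Pi.single r 1) e ≤ C := by
  have := linkLoad_sub_single h e
  have := x.2 e
  omega

lemma sum_jumpRate_mul (x : State n C) (ψ : (Route n → ℕ) → ℝ) :
    ∑ y : State n C, jumpRate lam x y * ψ y.1 =
      ∑ r, (arrivalRate lam C x.1 r * ψ (x.1 + Pi.single r 1) +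
        x.1 r * ψ (x.1 - Pi.single r 1)) := by
  simp only [jumpRate, Finset.sum_mul]
  rw [Finset.sum_comm]
  refine Finset.sum_congr rfl fun r _ => ?_
  simp only [add_mul, Finset.sum_add_distrib]
  congr 1
  · by_cases h : arrivalRate lam C x.1 r = 0
    · simp [h]
    refine (Finset.sum_eq_single (⟨x.1 + Pi.single r 1, linkLoad_add_single_le h⟩ : State n C)
      (fun y _ hy => ?_) fun h' => absurd (Finset.mem_univ (α := State n C) _) h').trans
      (by rw [if_pos rfl])
    rw [if_neg fun h' => hy (Subtype.ext h'), zero_mul]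
  · by_cases h : x.1 r = 0
    · simp [h]
    refine (Finset.sum_eq_single (⟨x.1 - Pi.single r 1, linkLoad_sub_single_le x h⟩ : State n C)
      (fun y _ hy => ?_) fun h' => absurd (Finset.mem_univ (α := State n C) _) h').trans
      (by rw [if_pos (sub_single_add_single h).symm])
    rw [if_neg fun h' => hy (Subtype.ext (by simp [h'])), zero_mul]

lemma sum_generator_mul (x : State n C) {ψ : (Route n → ℕ) → ℝ} (hψ : ψ x.1 = 0) :
    ∑ y : State n C, generator n C lam x y * ψ y.1 =
      ∑ r, (arrivalRate lam C x.1 r * ψ (x.1 + Pi.single r 1) +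
        x.1 r * ψ (x.1 - Pi.single r 1)) := by
  rw [← sum_jumpRate_mul]
  refine Finset.sum_congr rfl fun y _ => ?_
  by_cases h : x = y
  · simp [← h, hψ]
  · simp [generator, h]

lemma isQMatrix_generator (hlam : 0 ≤ lam) : IsQMatrix (generator n C lam) where
  nonneg x y hxy := by
    simp only [generator, hxy, if_false, jumpRate]
    refine Finset.sum_nonneg fun r _ => add_nonneg ?_ ?_
    · split_ifs
      exacts [arrivalRate_nonneg hlam _ _, le_rfl]
    · split_ifs <;> simp
  sum_row x := by
    rw [← Finset.add_sum_erase _ _ (Finset.mem_univ x), generator, if_pos rfl, neg_add_eq_zero,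
      Finset.filter_ne']
    exact Finset.sum_congr rfl fun y hy => (if_neg (Finset.ne_of_mem_erase hy).symm).symm

lemma exists_single_of_generator_ne_zero {x y : State n C} (hxy : x ≠ y)
    (h : generator n C lam x y ≠ 0) :
    ∃ r, y.1 = x.1 + Pi.single r 1 ∨ (x.1 r ≠ 0 ∧ y.1 = x.1 - Pi.single r 1) := by
  simp only [generator, hxy, if_false, jumpRate] at h
  obtain ⟨r, -, hr⟩ := Finset.exists_ne_zero_of_sum_ne_zero h
  refine ⟨r, ?_⟩
  by_contra! hc
  refine hr ?_
  rw [if_neg hc.1, if_neg fun h' => hc.2 ?_ ?_, add_zero] <;> simp [h']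

/-- The generator of the network, as an operator on functions of arbitrary load vectors: calls join
the route `r` at rate `arrivalRate lam C x r` and leave it at rate `x r`. -/
def loadGen (lam : ℝ) (C : ℕ) (g : (Route n → ℕ) → ℝ) (x : Route n → ℕ) : ℝ :=
  ∑ r, (arrivalRate lam C x r * (g (x + Pi.single r 1) - g x) +
    x r * (g (x - Pi.single r 1) - g x))

lemma generator_mulVec (hlam : 0 ≤ lam) (g : (Route n → ℕ) → ℝ) (x : State n C) :
    (generator n C lam).mulVec (fun y => g y.1) x = loadGen lam C g x.1 :=
  ((isQMatrix_generator hlam).mulVec_apply _ x).trans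
    (sum_generator_mul x (ψ := fun y => g y - g x.1) (sub_self _))

lemma loadGen_sum {ι : Type*} (s : Finset ι) (g : ι → (Route n → ℕ) → ℝ) (x : Route n → ℕ) :
    loadGen lam C (fun y => ∑ i ∈ s, g i y) x = ∑ i ∈ s, loadGen lam C (g i) x := by
  simp only [loadGen]
  rw [Finset.sum_comm]
  refine Finset.sum_congr rfl fun r _ => ?_
  simp only [← Finset.sum_sub_distrib, Finset.mul_sum, Finset.sum_add_distrib]

lemma loadGen_const_mul (a : ℝ) (g : (Route n → ℕ) → ℝ) (x : Route n → ℕ) :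
    loadGen lam C (fun y => a * g y) x = a * loadGen lam C g x := by
  simp only [loadGen, ← mul_sub, mul_left_comm _ a, ← mul_add, Finset.mul_sum]

/-- The rate at which calls join the link `e`. -/
def linkRate (lam : ℝ) (C : ℕ) (x : Route n → ℕ) (e : Sym2 (Fin n)) : ℝ :=
  ∑ r with r.Uses e, arrivalRate lam C x r

/-- The indicator that the link `e` has load `k`. -/
def level (x : Route n → ℕ) (e : Sym2 (Fin n)) (k : ℕ) : ℝ :=
  if linkLoad x e = k then 1 else 0

lemma level_nonneg (x : Route n → ℕ) (e : Sym2 (Fin n)) (k : ℕ) : 0 ≤ level x e k := by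
  unfold level; split_ifs <;> simp

lemma level_le_one (x : Route n → ℕ) (e : Sym2 (Fin n)) (k : ℕ) : level x e k ≤ 1 := by
  unfold level; split_ifs <;> simp

lemma level_add_single_sub (x : Route n → ℕ) (r : Route n) (e : Sym2 (Fin n)) (k : ℕ) :
    level (x + Pi.single r 1) e k - level x e k = if r.Uses e then
      (if linkLoad x e + 1 = k then 1 else 0) - (if linkLoad x e = k then 1 else 0) else 0 := by
  simp only [level, linkLoad_add_single]
  split_ifs <;> simp_all

lemma level_sub_single_sub {x : Route n → ℕ} {r : Route n} (hr : x r ≠ 0) (e : Sym2 (Fin n))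
    (k : ℕ) :
    level (x - Pi.single r 1) e k - level x e k = if r.Uses e then
      (if linkLoad x e = k + 1 then 1 else 0) - (if linkLoad x e = k then 1 else 0) else 0 := by
  have hload := linkLoad_sub_single hr e
  simp only [level, hload]
  split_ifs at hload ⊢ <;> simp_all

lemma loadGen_level (x : Route n → ℕ) (e : Sym2 (Fin n)) (k : ℕ) :
    loadGen lam C (fun y => level y e k) x =
      linkRate lam C x e *
        ((if linkLoad x e + 1 = k then 1 else 0) - (if linkLoad x e = k then 1 else 0)) +
      linkLoad x e *
        ((if linkLoad x e = k + 1 then 1 else 0) - (if linkLoad x e = k then 1 else 0)) := by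
  simp only [loadGen, Finset.sum_add_distrib]
  congr 1
  · simp only [level_add_single_sub, linkRate, Finset.sum_mul, Finset.sum_filter, mul_ite,
      ite_mul, mul_zero, zero_mul]
  · simp only [linkLoad, Nat.cast_sum, Finset.sum_mul]
    rw [Finset.sum_filter]
    refine Finset.sum_congr rfl fun r _ => ?_
    by_cases hr : x r = 0
    · simp [hr]
    rw [level_sub_single_sub hr, mul_ite, mul_zero]
    rfl

lemma abs_level_add_single_sub_le (x : Route n → ℕ) (r : Route n) (e : Sym2 (Fin n)) (k : ℕ) :
    |level (x + Pi.single r 1) e k - level x e k| ≤ if r.Uses e then 1 else 0 := by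
  rw [level_add_single_sub]
  split_ifs <;> simp

lemma abs_level_sub_single_sub_le {x : Route n → ℕ} {r : Route n} (hr : x r ≠ 0)
    (e : Sym2 (Fin n)) (k : ℕ) :
    |level (x - Pi.single r 1) e k - level x e k| ≤ if r.Uses e then 1 else 0 := by
  rw [level_sub_single_sub hr]
  split_ifs <;> simp

/-- The product rule for the generator, up to the jumps that change both factors. -/
lemma abs_loadGen_level_mul_level_sub_le (hlam : 0 ≤ lam) (x : Route n → ℕ)
    (e e' : Sym2 (Fin n)) (j k : ℕ) :
    |loadGen lam C (fun y => level y e j * level y e' k) x -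
      (loadGen lam C (fun y => level y e j) x * level x e' k +
        level x e j * loadGen lam C (fun y => level y e' k) x)| ≤
      ∑ r, (arrivalRate lam C x r + x r) *
        ((if r.Uses e then 1 else 0) * (if r.Uses e' then 1 else 0)) := by
  have hmul {b b' u u' : ℝ} (hb : |b| ≤ u) (hb' : |b'| ≤ u') : |b * b'| ≤ u * u' := by
    rw [abs_mul]
    exact mul_le_mul hb hb' (abs_nonneg _) ((abs_nonneg _).trans hb)
  simp only [loadGen]
  rw [Finset.sum_mul, Finset.mul_sum, ← Finset.sum_add_distrib, ← Finset.sum_sub_distrib]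
  refine (Finset.abs_sum_le_sum_abs _ _).trans (Finset.sum_le_sum fun r _ => ?_)
  have ha := arrivalRate_nonneg (C := C) hlam x r
  calc _ = |arrivalRate lam C x r *
        ((level (x + Pi.single r 1) e j - level x e j) *
          (level (x + Pi.single r 1) e' k - level x e' k)) +
        x r * ((level (x - Pi.single r 1) e j - level x e j) *
          (level (x - Pi.single r 1) e' k - level x e' k))| := by
        congr 1; ring
    _ ≤ _ := by
        rw [add_mul]
        refine (abs_add_le _ _).trans (add_le_add ?_ ?_)
        · rw [abs_mul, abs_of_nonneg ha]
          exact mul_le_mul_of_nonneg_left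
            (hmul (abs_level_add_single_sub_le ..) (abs_level_add_single_sub_le ..)) ha
        · by_cases hr : x r = 0
          · simp [hr]
          rw [abs_mul, Nat.abs_cast]
          exact mul_le_mul_of_nonneg_left (hmul (abs_level_sub_single_sub_le hr ..)
            (abs_level_sub_single_sub_le hr ..)) (Nat.cast_nonneg _)

end Generator

section Links

variable {n C : ℕ} {lam : ℝ}

/-- The nodes different from `v` and `w`. -/
abbrev Others (v w : Fin n) : Type := {z : Fin n // z ≠ v ∧ z ≠ w}

lemma card_others {v w : Fin n} (h : v ≠ w) :
    (Finset.card {z : Fin n | z ≠ v ∧ z ≠ w} : ℝ) = n - 2 := by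
  have hcompl : ({z : Fin n | z ≠ v ∧ z ≠ w} : Finset (Fin n)) = {v, w}ᶜ := by
    ext; simp
  rw [hcompl, Finset.card_compl, Nat.cast_sub (Finset.card_le_univ _), Finset.card_pair h,
    Fintype.card_fin, Nat.cast_two]

lemma two_le_of_ne {v w : Fin n} (h : v ≠ w) : (2 : ℝ) ≤ n :=
  sub_nonneg.1 ((card_others h).symm ▸ Nat.cast_nonneg _)

/-- The two-link route from `v` to `z` through `w`. -/
def Route.via (v w : Fin n) (h : v ≠ w) (z : Others v w) : Route n where
  ends := s(v, z.1)
  mid := some w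
  ends_ne := by simpa using z.2.1.symm
  mid_ne := by
    rintro _ ⟨⟩
    simp only [Sym2.mem_iff, not_or]
    exact ⟨h.symm, z.2.2.symm⟩

/-- The direct route between `v` and `w`. -/
def Route.direct (v w : Fin n) (h : v ≠ w) : Route n where
  ends := s(v, w)
  mid := none
  ends_ne := by simpa using h
  mid_ne := by simp

/-- The routes that occupy the link `{v, w}`: the direct one, and the two-link routes through `w`
from `v` and through `v` from `w`. -/
def routesThrough (v w : Fin n) (h : v ≠ w) : Option (Others v w ⊕ Others w v) → Route n
  | none => Route.direct v w h
  | some (Sum.inl z) => Route.via v w h z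
  | some (Sum.inr z) => Route.via w v h.symm z

lemma routesThrough_injective {v w : Fin n} (h : v ≠ w) :
    Function.Injective (routesThrough v w h) := by
  rintro (_ | ⟨z, hz⟩ | ⟨z, hz⟩) (_ | ⟨z', hz'⟩ | ⟨z', hz'⟩) heq <;>
    simp only [routesThrough, Route.direct, Route.via, Route.ext_iff, Sym2.eq_iff,
      Option.some.injEq, reduceCtorEq, and_false] at heq
  · rfl
  · obtain rfl : z = z' := by tauto
    rfl
  · exact absurd heq.2.symm h
  · exact absurd heq.2 h
  · obtain rfl : z = z' := by tauto
    rfl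

lemma uses_iff {v w : Fin n} (h : v ≠ w) (r : Route n) :
    r.Uses s(v, w) ↔ r ∈ Set.range (routesThrough v w h) := by
  constructor
  · obtain ⟨e, m, he, hm⟩ := r
    cases m with
    | none => exact fun hu => ⟨none, Route.ext hu rfl⟩
    | some m =>
      rintro ⟨c, hc, heq⟩
      obtain ⟨z, rfl⟩ := Sym2.mem_iff_exists.1 hc
      have hm' : m ∉ s(c, z) := hm m rfl
      simp only [Sym2.mk_isDiag_iff, Sym2.mem_iff, not_or] at he hm'
      obtain ⟨rfl, rfl⟩ | ⟨rfl, rfl⟩ := Sym2.eq_iff.1 heq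
      exacts [⟨some (Sum.inl ⟨z, Ne.symm he, Ne.symm hm'.2⟩), rfl⟩,
        ⟨some (Sum.inr ⟨z, Ne.symm he, Ne.symm hm'.2⟩), rfl⟩]
  · rintro ⟨_ | z | z, rfl⟩
    · rfl
    · exact ⟨v, Sym2.mem_mk_left v z.1, rfl⟩
    · exact ⟨w, Sym2.mem_mk_left w z.1, Sym2.eq_swap⟩

lemma sum_uses {v w : Fin n} (h : v ≠ w) (a : Route n → ℝ) :
    ∑ r with r.Uses s(v, w), a r = a (Route.direct v w h) +
      (∑ z : Others v w, a (Route.via v w h z) + ∑ z : Others w v, a (Route.via w v h.symm z)) := by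
  have hmap : ({r | r.Uses s(v, w)} : Finset (Route n)) =
      Finset.univ.map ⟨_, routesThrough_injective h⟩ := by
    ext r
    simp [uses_iff h]
  rw [hmap, Finset.sum_map, Fintype.sum_option, Fintype.sum_sum_type]
  rfl

/-- The proportion of nodes `z` for which exactly one of the links `{v, z}` and `{w, z}` is full. -/
def altShare (C : ℕ) (x : Route n → ℕ) (v w : Fin n) : ℝ :=
  1 / ((n : ℝ) - 2) * ∑ z with z ≠ v ∧ z ≠ w,
    (level x s(v, z) C * (1 - level x s(w, z) C) + level x s(w, z) C * (1 - level x s(v, z) C))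

lemma altShare_le_one (x : Route n → ℕ) {v w : Fin n} (h : v ≠ w) : altShare C x v w ≤ 1 := by
  rw [altShare, one_div_mul_eq_div]
  refine div_le_one_of_le₀ ((Finset.sum_le_card_nsmul _ _ 1 fun z _ => ?_).trans_eq ?_)
    (sub_nonneg.2 (two_le_of_ne h))
  · unfold level; split_ifs <;> simp
  · rw [nsmul_eq_mul, mul_one, card_others h]

lemma arrivalRate_via (x : State n C) {v w : Fin n} (h : v ≠ w) (z : Others v w)
    (hl : linkLoad x.1 s(v, w) < C) :
    arrivalRate lam C x.1 (Route.via v w h z) =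
      lam / ((n : ℝ) - 2) * (level x.1 s(v, z.1) C * (1 - level x.1 s(w, z.1) C)) := by
  have h1 := x.2 s(v, z.1)
  have h2 := x.2 s(w, z.1)
  have hfree : (∀ e, (Route.via v w h z).Uses e → linkLoad x.1 e < C) ↔
      linkLoad x.1 s(w, z.1) < C := by
    refine ⟨fun H => H _ ⟨z.1, Sym2.mem_mk_right v z.1, Sym2.eq_swap⟩, ?_⟩
    rintro H e ⟨a, ha, rfl⟩
    obtain rfl | rfl := Sym2.mem_iff.1 (show a ∈ s(v, z.1) from ha)
    · exact hl
    · rwa [Sym2.eq_swap]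
  simp only [arrivalRate, Route.via] at hfree ⊢
  simp only [hfree, level]
  split_ifs <;> first | (exfalso; omega) | simp

lemma linkRate_eq (x : State n C) {v w : Fin n} (h : v ≠ w)
    (hl : linkLoad x.1 s(v, w) < C) :
    linkRate lam C x.1 s(v, w) = lam * (1 + altShare C x.1 v w) := by
  have hdirect : arrivalRate lam C x.1 (Route.direct v w h) = lam := if_pos hl
  simp only [linkRate, sum_uses h, hdirect, arrivalRate_via x h _ hl,
    arrivalRate_via x h.symm _ (Sym2.eq_swap (a := v) (b := w) ▸ hl)]
  rw [altShare, Finset.sum_add_distrib, ← Finset.mul_sum, ← Finset.mul_sum,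
    Finset.sum_subtype {z | z ≠ v ∧ z ≠ w} (p := fun z => z ≠ v ∧ z ≠ w) (by simp)
      fun z => level x.1 s(v, z) C * (1 - level x.1 s(w, z) C),
    Finset.sum_subtype {z | z ≠ v ∧ z ≠ w} (p := fun z => z ≠ w ∧ z ≠ v) (by simp [and_comm])
      fun z => level x.1 s(w, z) C * (1 - level x.1 s(v, z) C)]
  ring

lemma linkRate_eq_zero {x : Route n → ℕ} {e : Sym2 (Fin n)} (hl : C ≤ linkLoad x e) :
    linkRate lam C x e = 0 := by
  refine Finset.sum_eq_zero fun r hr => ?_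
  by_contra h
  exact hl.not_gt (linkLoad_lt_of_arrivalRate_ne_zero h (Finset.mem_filter.1 hr).2)

lemma linkRate_le (hlam : 0 ≤ lam) (x : State n C) {v w : Fin n} (h : v ≠ w) :
    linkRate lam C x.1 s(v, w) ≤ 2 * lam := by
  obtain hl | hl := lt_or_ge (linkLoad x.1 s(v, w)) C
  · rw [linkRate_eq x h hl]
    nlinarith [altShare_le_one (C := C) x.1 h]
  · rw [linkRate_eq_zero hl]
    positivity

/-- The number of links at `v` that the route `r` occupies. -/
def degAt (v : Fin n) (r : Route n) : ℝ :=
  ∑ w with w ≠ v, if r.Uses s(v, w) then 1 else 0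

lemma degAt_nonneg (v : Fin n) (r : Route n) : 0 ≤ degAt v r :=
  Finset.sum_nonneg fun _ _ => by split_ifs <;> simp

lemma exists_forall_uses_eq_or_eq (v : Fin n) (r : Route n) :
    ∃ c d : Fin n, ∀ w, r.Uses s(v, w) → w = c ∨ w = d := by
  obtain ⟨e, m, he, hm⟩ := r
  induction e using Sym2.ind with
  | _ a b =>
    cases m with
    | none =>
      refine ⟨a, b, fun w (hw : s(v, w) = s(a, b)) => ?_⟩
      rw [Sym2.eq_iff] at hw
      tauto
    | some m =>
      obtain rfl | hv := eq_or_ne v m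
      · refine ⟨a, b, ?_⟩
        rintro w ⟨c, hc, heq⟩
        have hcv : v ≠ c := fun h => hm v rfl (h ▸ hc)
        obtain ⟨h, -⟩ | ⟨-, rfl⟩ := Sym2.eq_iff.1 heq
        exacts [absurd h hcv, Sym2.mem_iff.1 hc]
      · refine ⟨m, m, ?_⟩
        rintro w ⟨c, -, heq⟩
        rw [Sym2.eq_iff] at heq
        tauto

lemma degAt_le_two (v : Fin n) (r : Route n) : degAt v r ≤ 2 := by
  obtain ⟨c, d, hcd⟩ := exists_forall_uses_eq_or_eq v r
  rw [degAt, Finset.sum_boole]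
  have hsub : ({w ∈ ({w | w ≠ v} : Finset (Fin n)) | r.Uses s(v, w)}) ⊆ {c, d} := fun w hw => by
    simpa using hcd w (Finset.mem_filter.1 hw).2
  exact_mod_cast (Finset.card_le_card hsub).trans Finset.card_le_two

lemma sum_rate_mul_degAt_le (hlam : 0 ≤ lam) (x : State n C) (v : Fin n) :
    ∑ r, (arrivalRate lam C x.1 r + x.1 r) * degAt v r ≤ n * (2 * lam + C) := by
  simp only [degAt, Finset.mul_sum]
  rw [Finset.sum_comm]
  refine (Finset.sum_le_card_nsmul _ _ (2 * lam + C) fun w hw => ?_).trans ?_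
  · have hrate := linkRate_le hlam x (Finset.mem_filter.1 hw).2.symm
    have hload : (linkLoad x.1 s(v, w) : ℝ) ≤ C := by exact_mod_cast x.2 _
    rw [linkRate, Finset.sum_filter] at hrate
    rw [linkLoad, Nat.cast_sum, Finset.sum_filter] at hload
    refine le_trans (le_of_eq ?_) (add_le_add hrate hload)
    simp only [mul_ite, mul_one, mul_zero, ← Finset.sum_filter, Finset.sum_add_distrib]
  · rw [nsmul_eq_mul]
    refine mul_le_mul_of_nonneg_right ?_ (by positivity)
    exact_mod_cast (Finset.card_le_univ _).trans_eq (Fintype.card_fin n)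

/-- The two-link routes with endpoints `u` and `v`. -/
def indirect (u v : Fin n) : Finset (Route n) :=
  {r | r.ends = s(u, v) ∧ r.mid ≠ none}

lemma exists_mid_of_mem_indirect {u v : Fin n} {r : Route n} (hr : r ∈ indirect u v) :
    ∃ w, r.mid = some w ∧ w ≠ u ∧ w ≠ v := by
  obtain ⟨hends, hmid⟩ := (Finset.mem_filter.1 hr).2
  obtain ⟨w, hw⟩ := Option.ne_none_iff_exists'.1 hmid
  have hne := r.mid_ne w hw
  rw [hends, Sym2.mem_iff, not_or] at hne
  exact ⟨w, hw, hne⟩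

lemma Route.ends_mid_of_uses_of_uses {u v w : Fin n} (huv : u ≠ v) (hwu : w ≠ u) (hwv : w ≠ v)
    {r : Route n} (hu : r.Uses s(u, w)) (hv : r.Uses s(v, w)) :
    r.ends = s(u, v) ∧ r.mid = some w := by
  obtain ⟨e, m, he, hm⟩ := r
  cases m with
  | none =>
    have heq : s(u, w) = s(v, w) := Eq.trans hu (Eq.symm hv)
    rw [Sym2.eq_iff] at heq
    tauto
  | some m =>
    obtain ⟨a, ha, hu⟩ := hu
    obtain ⟨b, hb, hv⟩ := hv
    rw [Sym2.eq_iff] at hu hv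
    obtain ⟨rfl, rfl, rfl⟩ : a = u ∧ b = v ∧ m = w := by grind
    exact ⟨(Sym2.mem_and_mem_iff huv).1 ⟨ha, hb⟩, rfl⟩

lemma sum_uses_mul_uses_le {u v : Fin n} (huv : u ≠ v) (r : Route n) :
    ∑ w with w ≠ u ∧ w ≠ v,
      ((if r.Uses s(u, w) then 1 else 0) * (if r.Uses s(v, w) then 1 else 0) : ℝ) ≤
      if r ∈ indirect u v then 1 else 0 := by
  have key {w} (hw : w ∈ ({w | w ≠ u ∧ w ≠ v} : Finset (Fin n)))
      (h : r.Uses s(u, w) ∧ r.Uses s(v, w)) :=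
    have hw := (Finset.mem_filter.1 hw).2
    Route.ends_mid_of_uses_of_uses huv hw.1 hw.2 h.1 h.2
  simp only [ite_zero_mul_ite_zero, mul_one]
  rw [Finset.sum_boole]
  split_ifs with h
  · refine Nat.cast_le_one.2 (Finset.card_le_one.2 fun a ha b hb => ?_)
    rw [Finset.mem_filter] at ha hb
    exact Option.some.inj ((key ha.1 ha.2).2.symm.trans (key hb.1 hb.2).2)
  · rw [Nat.cast_nonpos, Finset.card_eq_zero, Finset.filter_eq_empty_iff]
    intro w hw huses
    have hr := key hw huses
    exact h (by simp [indirect, hr.1, hr.2])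

lemma card_indirect_le {u v : Fin n} (huv : u ≠ v) : ((indirect u v).card : ℝ) ≤ n - 2 := by
  rw [← card_others huv, ← Finset.card_image_of_injective _ (Option.some_injective (Fin n))]
  refine Nat.cast_le.2 (Finset.card_le_card_of_injOn Route.mid (fun r hr => ?_)
    fun r hr r' hr' h => ?_)
  · obtain ⟨w, hmid, hw⟩ := exists_mid_of_mem_indirect hr
    simp [hmid, hw]
  · exact Route.ext ((Finset.mem_filter.1 hr).2.1.trans (Finset.mem_filter.1 hr').2.1.symm) h

lemma sum_arrivalRate_indirect_le (hlam : 0 ≤ lam) (x : Route n → ℕ) {u v : Fin n}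
    (huv : u ≠ v) : ∑ r ∈ indirect u v, arrivalRate lam C x r ≤ lam := by
  have hn : 0 ≤ (n : ℝ) - 2 := sub_nonneg.2 (two_le_of_ne huv)
  calc ∑ r ∈ indirect u v, arrivalRate lam C x r
      ≤ (indirect u v).card • (lam / ((n : ℝ) - 2)) :=
        Finset.sum_le_card_nsmul _ _ _ fun r hr => by
          obtain ⟨w, hw, -⟩ := exists_mid_of_mem_indirect hr
          simp only [arrivalRate, hw]
          split_ifs
          exacts [le_rfl, div_nonneg hlam hn]
    _ = lam * ((indirect u v).card / ((n : ℝ) - 2)) := by rw [nsmul_eq_mul]; ring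
    _ ≤ lam := mul_le_of_le_one_right hlam (div_le_one_of_le₀ (card_indirect_le huv) hn)

lemma one_le_degAt {u v : Fin n} {r : Route n} (hr : r ∈ indirect u v) :
    1 ≤ degAt u r := by
  obtain ⟨w, hmid, hwu, -⟩ := exists_mid_of_mem_indirect hr
  have huses : r.Uses s(u, w) := by
    simp only [Route.Uses, hmid]
    exact ⟨u, by simp [(Finset.mem_filter.1 hr).2.1], rfl⟩
  calc (1 : ℝ) = if r.Uses s(u, w) then 1 else 0 := (if_pos huses).symm
    _ ≤ degAt u r := Finset.single_le_sum (f := fun w => if r.Uses s(u, w) then (1 : ℝ) else 0)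
        (fun _ _ => by split_ifs <;> simp) (by simpa using hwu)

end Links

section Drift

variable {n C : ℕ} {lam : ℝ}

/-- The vector field of the limiting equation, with the share `c` of alternatively routed calls
frozen; it is linear in `y`. -/
def linDrift (lam : ℝ) (C : ℕ) (c : ℝ) (y : ℕ → ℝ) (k : ℕ) : ℝ :=
  lam * (1 + c) * ((if 0 < k then y (k - 1) else 0) - (if k < C then y k else 0)) +
    (k + 1) * y (k + 1) - k * y k

lemma linDrift_sum {ι : Type*} (s : Finset ι) (c : ℝ) (y : ι → ℕ → ℝ) (k : ℕ) :
    linDrift lam C c (fun i => ∑ w ∈ s, y w i) k = ∑ w ∈ s, linDrift lam C c (y w) k := by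
  simp only [linDrift, Finset.sum_sub_distrib, Finset.sum_add_distrib, ← Finset.mul_sum]
  split_ifs <;> simp

lemma linDrift_const_mul (c a : ℝ) (y : ℕ → ℝ) (k : ℕ) :
    linDrift lam C c (fun i => a * y i) k = a * linDrift lam C c y k := by
  simp only [linDrift]
  split_ifs <;> ring

lemma linDrift_sub (c : ℝ) (y z : ℕ → ℝ) (k : ℕ) :
    linDrift lam C c (fun i => y i - z i) k = linDrift lam C c y k - linDrift lam C c z k := by
  simp only [linDrift]
  split_ifs <;> ring

lemma abs_linDrift_sub_le (hlam : 0 ≤ lam) {c c' : ℝ} {y : ℕ → ℝ} (hy₀ : ∀ i, 0 ≤ y i)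
    (hy₁ : ∀ i, y i ≤ 1) (k : ℕ) :
    |linDrift lam C c y k - linDrift lam C c' y k| ≤ lam * |c - c'| := by
  have hdiff : linDrift lam C c y k - linDrift lam C c' y k =
      lam * (c - c') * ((if 0 < k then y (k - 1) else 0) - (if k < C then y k else 0)) := by
    simp only [linDrift]; ring
  rw [hdiff, abs_mul, abs_mul, abs_of_nonneg hlam]
  refine mul_le_of_le_one_right (by positivity) ?_
  have := hy₀ (k - 1); have := hy₀ k; have := hy₁ (k - 1); have := hy₁ k
  rw [abs_le]
  split_ifs <;> constructor <;> linarith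

lemma abs_linDrift_le (hlam : 0 ≤ lam) {c : ℝ} (hc₀ : 0 ≤ c) (hc₁ : c ≤ 1) {y : ℕ → ℝ} {B : ℝ}
    (hy : ∀ i ≤ C, |y i| ≤ B) (hyC : y (C + 1) = 0) {k : ℕ} (hk : k ≤ C) :
    |linDrift lam C c y k| ≤ (4 * lam + 2 * C + 1) * B := by
  have hB : 0 ≤ B := (abs_nonneg _).trans (hy 0 (Nat.zero_le _))
  have hkC : (k : ℝ) ≤ C := by exact_mod_cast hk
  have hprev : |if 0 < k then y (k - 1) else 0| ≤ B := by
    split_ifs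
    exacts [hy _ (by omega), by simpa using hB]
  have hcur : |if k < C then y k else 0| ≤ B := by
    split_ifs
    exacts [hy _ hk, by simpa using hB]
  have hnext : |y (k + 1)| ≤ B := by
    obtain h | rfl := hk.lt_or_eq
    exacts [hy _ h, by simpa [hyC] using hB]
  calc |linDrift lam C c y k|
      ≤ lam * (1 + c) * (|if 0 < k then y (k - 1) else 0| + |if k < C then y k else 0|) +
          (k + 1) * |y (k + 1)| + k * |y k| := by
        rw [linDrift]
        refine (abs_sub _ _).trans (add_le_add ((abs_add_le _ _).trans (add_le_add ?_ ?_)) ?_)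
        · rw [abs_mul, abs_of_nonneg (by positivity : 0 ≤ lam * (1 + c))]
          exact mul_le_mul_of_nonneg_left (abs_sub _ _) (by positivity)
        · rw [abs_mul, abs_of_nonneg (by positivity : (0 : ℝ) ≤ k + 1)]
        · rw [abs_mul, Nat.abs_cast]
    _ ≤ lam * (1 + 1) * (B + B) + (C + 1) * B + C * B := by
        gcongr
        exact hy k hk
    _ = (4 * lam + 2 * C + 1) * B := by ring

lemma abs_linDrift_sub_linDrift_le (hlam : 0 ≤ lam) {c : ℝ} (hc₀ : 0 ≤ c) (hc₁ : c ≤ 1)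
    {y z : ℕ → ℝ} {B : ℝ} (hyz : ∀ i ≤ C, |y i - z i| ≤ B) (hC : y (C + 1) = z (C + 1)) {k : ℕ}
    (hk : k ≤ C) :
    |linDrift lam C c y k - linDrift lam C c z k| ≤ (4 * lam + 2 * C + 1) * B := by
  rw [← linDrift_sub]
  exact abs_linDrift_le hlam hc₀ hc₁ hyz (sub_eq_zero.2 hC) hk

lemma loadGen_level_eq_linDrift (x : State n C) {v w : Fin n} (h : v ≠ w) {k : ℕ} (hk : k ≤ C) :
    loadGen lam C (fun y => level y s(v, w) k) x.1 =
      linDrift lam C (altShare C x.1 v w) (level x.1 s(v, w)) k := by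
  have hload := x.2 s(v, w)
  have hjoin : linkRate lam C x.1 s(v, w) *
        ((if linkLoad x.1 s(v, w) + 1 = k then 1 else 0) -
          (if linkLoad x.1 s(v, w) = k then 1 else 0)) =
      lam * (1 + altShare C x.1 v w) * ((if 0 < k then level x.1 s(v, w) (k - 1) else 0) -
        (if k < C then level x.1 s(v, w) k else 0)) := by
    obtain hlt | hge := lt_or_ge (linkLoad x.1 s(v, w)) C
    · rw [linkRate_eq x h hlt]
      congr 1
      unfold level
      split_ifs <;> first | rfl | (exfalso; omega)
    · rw [linkRate_eq_zero hge, zero_mul]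
      unfold level
      split_ifs <;> first | (exfalso; omega) | simp
  rw [loadGen_level, hjoin, linDrift, add_sub_assoc]
  congr 1
  unfold level
  split_ifs with hsucc heq heq
  · omega
  · rw [hsucc]; push_cast; ring
  · rw [heq]; ring
  · simp

/-- The number of links at `v` with load `k`. -/
def starCount (v : Fin n) (k : ℕ) (x : Route n → ℕ) : ℝ :=
  ∑ w with w ≠ v, level x s(v, w) k

/-- The number of nodes `w` whose links to `u` and `v` have loads `j` and `k`. -/
def pairCount (u v : Fin n) (j k : ℕ) (x : Route n → ℕ) : ℝ :=
  ∑ w with w ≠ u ∧ w ≠ v, level x s(u, w) j * level x s(v, w) k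

/-- The number of indirectly routed calls between `u` and `v`. -/
def indirectCount (u v : Fin n) (x : Route n → ℕ) : ℝ :=
  ∑ r ∈ indirect u v, (x r : ℝ)

lemma sum_level_others (x : Route n → ℕ) {v w : Fin n} (h : w ≠ v) (k : ℕ) :
    ∑ z with z ≠ v ∧ z ≠ w, level x s(v, z) k = starCount v k x - level x s(v, w) k := by
  rw [← Finset.filter_filter, Finset.filter_ne', starCount,
    Finset.sum_erase_eq_sub (by simpa using h)]

lemma altShare_eq (x : Route n → ℕ) {v w : Fin n} (h : v ≠ w) :
    altShare C x v w = 1 / ((n : ℝ) - 2) * ((starCount v C x - level x s(v, w) C) +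
      (starCount w C x - level x s(w, v) C) - 2 * pairCount v w C C x) := by
  rw [altShare, ← sum_level_others x h.symm, ← sum_level_others x h, pairCount]
  simp only [and_comm (a := _ ≠ w)]
  congr 1
  rw [Finset.mul_sum, ← Finset.sum_add_distrib, ← Finset.sum_sub_distrib]
  exact Finset.sum_congr rfl fun z _ => by ring

/-- The load vector `x` is within `E` of the profile `ζ`: the links at each node are distributed
according to `ζ`, the pairs of links to two given nodes according to `ζ ⊗ ζ`, and no two nodes have
many indirectly routed calls between them. -/
structure CloseTo (C : ℕ) (ζ : ℕ → ℝ) (E : ℝ) (x : Route n → ℕ) : Prop where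
  star : ∀ v, ∀ k ≤ C, |starCount v k x - ((n : ℝ) - 1) * ζ k| ≤ E
  pair : ∀ u v, u ≠ v → ∀ j ≤ C, ∀ k ≤ C,
    |pairCount u v j k x - ((n : ℝ) - 2) * (ζ j * ζ k)| ≤ 2 * E
  indirect_le : ∀ u v, u ≠ v → indirectCount u v x ≤ 2 * E

/-- A vector of proportions, with values in `[0, 1]`, indexed by the possible loads; it is extended
by zero to all natural numbers so that `k + 1` and `k - 1` need no side conditions. -/
structure IsProfile (C : ℕ) (ζ : ℕ → ℝ) : Prop where
  nonneg : ∀ k, 0 ≤ ζ k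
  le_one : ∀ k, ζ k ≤ 1
  eq_zero : ∀ k, C < k → ζ k = 0

/-- The value of `altShare` in a network with load profile `ζ` and asymptotically independent
links. -/
def share (C : ℕ) (ζ : ℕ → ℝ) : ℝ := 2 * ζ C * (1 - ζ C)

lemma IsProfile.share_nonneg {ζ : ℕ → ℝ} (h : IsProfile C ζ) : 0 ≤ share C ζ :=
  mul_nonneg (mul_nonneg zero_le_two (h.nonneg C)) (sub_nonneg.2 (h.le_one C))

lemma share_le_one (ζ : ℕ → ℝ) : share C ζ ≤ 1 := by
  unfold share
  nlinarith [sq_nonneg (2 * ζ C - 1)]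

lemma level_eq_zero (x : State n C) (e : Sym2 (Fin n)) {k : ℕ} (hk : C < k) :
    level x.1 e k = 0 :=
  if_neg ((x.2 e).trans_lt hk).ne

lemma CloseTo.abs_altShare_sub_le {ζ : ℕ → ℝ} (hζ : IsProfile C ζ) {E : ℝ} {x : Route n → ℕ}
    (h : CloseTo C ζ E x) (hn : 2 < n) {v w : Fin n} (hvw : v ≠ w) :
    |altShare C x v w - share C ζ| ≤ (6 * E + 2) / ((n : ℝ) - 2) := by
  have hn' : (0 : ℝ) < (n : ℝ) - 2 := sub_pos.2 (by exact_mod_cast hn)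
  have hdiff : altShare C x v w - share C ζ = ((starCount v C x - ((n : ℝ) - 1) * ζ C) +
      (starCount w C x - ((n : ℝ) - 1) * ζ C) -
      2 * (pairCount v w C C x - ((n : ℝ) - 2) * (ζ C * ζ C)) + (ζ C - level x s(v, w) C) +
      (ζ C - level x s(w, v) C)) / ((n : ℝ) - 2) := by
    rw [altShare_eq x hvw, share]
    field_simp
    ring
  rw [hdiff, abs_div, abs_of_pos hn']
  refine div_le_div_of_nonneg_right ?_ hn'.le
  have hv := abs_le.1 (h.star v C le_rfl)
  have hw := abs_le.1 (h.star w C le_rfl)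
  have hpair := abs_le.1 (h.pair v w hvw C le_rfl C le_rfl)
  have := hζ.nonneg C
  have := hζ.le_one C
  have := level_nonneg x s(v, w) C
  have := level_le_one x s(v, w) C
  have := level_nonneg x s(w, v) C
  have := level_le_one x s(w, v) C
  rw [abs_le]
  constructor <;> linarith

lemma CloseTo.abs_loadGen_level_sub_le (hlam : 0 ≤ lam) (hn : 2 < n) {ζ : ℕ → ℝ}
    (hζ : IsProfile C ζ) {E : ℝ} {x : State n C} (h : CloseTo C ζ E x.1) {v w : Fin n}
    (hvw : v ≠ w) {k : ℕ} (hk : k ≤ C) :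
    |loadGen lam C (fun y => level y s(v, w) k) x.1 -
      linDrift lam C (share C ζ) (level x.1 s(v, w)) k| ≤ lam * ((6 * E + 2) / ((n : ℝ) - 2)) := by
  rw [loadGen_level_eq_linDrift x hvw hk]
  exact (abs_linDrift_sub_le hlam (level_nonneg _ _) (level_le_one _ _) k).trans
    (mul_le_mul_of_nonneg_left (h.abs_altShare_sub_le hζ hn hvw) hlam)

lemma CloseTo.abs_loadGen_starCount_sub_linDrift_le (hlam : 0 ≤ lam) (hn : 2 < n) {ζ : ℕ → ℝ}
    (hζ : IsProfile C ζ) {E : ℝ} {x : State n C} (h : CloseTo C ζ E x.1) (v : Fin n) {k : ℕ}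
    (hk : k ≤ C) :
    |loadGen lam C (starCount v k) x.1 -
      linDrift lam C (share C ζ) (fun i => starCount v i x.1) k| ≤ 2 * lam * (6 * E + 2) := by
  have hn' : (3 : ℝ) ≤ n := by exact_mod_cast hn
  have hE : 0 ≤ E := (abs_nonneg _).trans (h.star v k hk)
  have hcard : (Finset.card {w : Fin n | w ≠ v} : ℝ) = n - 1 := by
    rw [Finset.filter_ne', Finset.cast_card_erase_of_mem (Finset.mem_univ v), Finset.card_univ,
      Fintype.card_fin]
  unfold starCount
  rw [loadGen_sum, linDrift_sum, ← Finset.sum_sub_distrib]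
  calc _ ≤ _ := Finset.abs_sum_le_sum_abs _ _
    _ ≤ Finset.card {w : Fin n | w ≠ v} • (lam * ((6 * E + 2) / ((n : ℝ) - 2))) :=
        Finset.sum_le_card_nsmul _ _ _ fun w hw =>
          h.abs_loadGen_level_sub_le hlam hn hζ (Finset.mem_filter.1 hw).2.symm hk
    _ = ((n : ℝ) - 1) / ((n : ℝ) - 2) * (lam * (6 * E + 2)) := by
        rw [nsmul_eq_mul, hcard]; ring
    _ ≤ 2 * (lam * (6 * E + 2)) := by
        refine mul_le_mul_of_nonneg_right ?_ (by positivity)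
        rw [div_le_iff₀ (by linarith)]
        linarith
    _ = 2 * lam * (6 * E + 2) := by ring

lemma CloseTo.abs_loadGen_starCount_sub_le (hlam : 0 ≤ lam) (hn : 2 < n) {ζ : ℕ → ℝ}
    (hζ : IsProfile C ζ) {E : ℝ} {x : State n C} (h : CloseTo C ζ E x.1) (v : Fin n) {k : ℕ}
    (hk : k ≤ C) :
    |loadGen lam C (starCount v k) x.1 - ((n : ℝ) - 1) * linDrift lam C (share C ζ) ζ k| ≤
      (16 * lam + 2 * C + 1) * E + 4 * lam := by
  have hdrift := abs_linDrift_sub_linDrift_le hlam hζ.share_nonneg (share_le_one ζ)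
    (y := fun i => starCount v i x.1) (z := fun i => ((n : ℝ) - 1) * ζ i) (h.star v)
    (by simp [starCount, level_eq_zero, hζ.eq_zero]) hk
  rw [linDrift_const_mul] at hdrift
  calc _ ≤ 2 * lam * (6 * E + 2) + (4 * lam + 2 * C + 1) * E :=
        (abs_sub_le _ _ _).trans
          (add_le_add (h.abs_loadGen_starCount_sub_linDrift_le hlam hn hζ v hk) hdrift)
    _ = (16 * lam + 2 * C + 1) * E + 4 * lam := by ring

lemma abs_loadGen_pairCount_sub_sum_le (hlam : 0 ≤ lam) (x : Route n → ℕ) {u v : Fin n}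
    (huv : u ≠ v) (j k : ℕ) :
    |loadGen lam C (pairCount u v j k) x - ∑ w with w ≠ u ∧ w ≠ v,
        (loadGen lam C (fun y => level y s(u, w) j) x * level x s(v, w) k +
          level x s(u, w) j * loadGen lam C (fun y => level y s(v, w) k) x)| ≤
      lam + indirectCount u v x := by
  unfold pairCount
  rw [loadGen_sum, ← Finset.sum_sub_distrib]
  calc _ ≤ _ := Finset.abs_sum_le_sum_abs _ _
    _ ≤ ∑ w with w ≠ u ∧ w ≠ v, ∑ r, (arrivalRate lam C x r + x r) *
          ((if r.Uses s(u, w) then 1 else 0) * (if r.Uses s(v, w) then 1 else 0)) :=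
        Finset.sum_le_sum fun w _ => abs_loadGen_level_mul_level_sub_le hlam x _ _ j k
    _ ≤ ∑ r, (arrivalRate lam C x r + x r) * (if r ∈ indirect u v then 1 else 0) := by
        rw [Finset.sum_comm]
        refine Finset.sum_le_sum fun r _ => ?_
        rw [← Finset.mul_sum]
        exact mul_le_mul_of_nonneg_left (sum_uses_mul_uses_le huv r)
          (add_nonneg (arrivalRate_nonneg hlam _ _) (Nat.cast_nonneg _))
    _ = ∑ r ∈ indirect u v, arrivalRate lam C x r + indirectCount u v x := by
        rw [indirectCount, ← Finset.sum_add_distrib]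
        simp
    _ ≤ lam + indirectCount u v x :=
        add_le_add_left (sum_arrivalRate_indirect_le hlam _ huv) _

lemma sum_linDrift_mul_add (x : Route n → ℕ) (u v : Fin n) (c : ℝ) (j k : ℕ) :
    ∑ w with w ≠ u ∧ w ≠ v, (linDrift lam C c (level x s(u, w)) j * level x s(v, w) k +
        level x s(u, w) j * linDrift lam C c (level x s(v, w)) k) =
      linDrift lam C c (fun i => pairCount u v i k x) j +
        linDrift lam C c (fun i => pairCount u v j i x) k := by
  simp only [pairCount, linDrift_sum, Finset.sum_add_distrib, linDrift_const_mul]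
  simp only [mul_comm (level x s(u, _) _), linDrift_const_mul]
  simp only [mul_comm]

lemma abs_mul_add_mul_le {a b c d : ℝ} (hb : 0 ≤ b) (hb₁ : b ≤ 1) (hc : 0 ≤ c) (hc₁ : c ≤ 1) :
    |a * b + c * d| ≤ |a| + |d| := by
  refine (abs_add_le _ _).trans ?_
  rw [abs_mul, abs_mul, abs_of_nonneg hb, abs_of_nonneg hc]
  exact add_le_add (mul_le_of_le_one_right (abs_nonneg _) hb₁)
    (mul_le_of_le_one_left (abs_nonneg _) hc₁)

lemma CloseTo.abs_loadGen_pairCount_sub_linDrift_le (hlam : 0 ≤ lam) (hn : 2 < n) {ζ : ℕ → ℝ}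
    (hζ : IsProfile C ζ) {E : ℝ} {x : State n C} (h : CloseTo C ζ E x.1) {u v : Fin n}
    (huv : u ≠ v) {j k : ℕ} (hj : j ≤ C) (hk : k ≤ C) :
    |loadGen lam C (pairCount u v j k) x.1 -
      (linDrift lam C (share C ζ) (fun i => pairCount u v i k x.1) j +
        linDrift lam C (share C ζ) (fun i => pairCount u v j i x.1) k)| ≤
      lam + 2 * E + 2 * lam * (6 * E + 2) := by
  have hn' : (0 : ℝ) < (n : ℝ) - 2 := sub_pos.2 (by exact_mod_cast hn)
  have hproduct := (abs_loadGen_pairCount_sub_sum_le (C := C) hlam x.1 huv j k).trans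
    (add_le_add_right (h.indirect_le u v huv) lam)
  refine (abs_sub_le _ _ _).trans (add_le_add hproduct ?_)
  rw [← sum_linDrift_mul_add, ← Finset.sum_sub_distrib]
  calc _ ≤ _ := Finset.abs_sum_le_sum_abs _ _
    _ ≤ Finset.card {w : Fin n | w ≠ u ∧ w ≠ v} •
          (2 * (lam * ((6 * E + 2) / ((n : ℝ) - 2)))) := by
        refine Finset.sum_le_card_nsmul _ _ _ fun w hw => ?_
        obtain ⟨hwu, hwv⟩ := (Finset.mem_filter.1 hw).2
        rw [add_sub_add_comm, ← sub_mul, ← mul_sub, two_mul]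
        exact (abs_mul_add_mul_le (level_nonneg _ _ _) (level_le_one _ _ _)
          (level_nonneg _ _ _) (level_le_one _ _ _)).trans
          (add_le_add (h.abs_loadGen_level_sub_le hlam hn hζ hwu.symm hj)
            (h.abs_loadGen_level_sub_le hlam hn hζ hwv.symm hk))
    _ = 2 * lam * (6 * E + 2) := by
        rw [nsmul_eq_mul, card_others huv]
        field_simp

lemma CloseTo.abs_loadGen_pairCount_sub_le (hlam : 0 ≤ lam) (hn : 2 < n) {ζ : ℕ → ℝ}
    (hζ : IsProfile C ζ) {E : ℝ} {x : State n C} (h : CloseTo C ζ E x.1) {u v : Fin n}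
    (huv : u ≠ v) {j k : ℕ} (hj : j ≤ C) (hk : k ≤ C) :
    |loadGen lam C (pairCount u v j k) x.1 - ((n : ℝ) - 2) *
      (linDrift lam C (share C ζ) ζ j * ζ k + ζ j * linDrift lam C (share C ζ) ζ k)| ≤
      (28 * lam + 8 * C + 6) * E + 5 * lam := by
  have hdrift_left := abs_linDrift_sub_linDrift_le hlam hζ.share_nonneg (share_le_one ζ)
    (y := fun i => pairCount u v i k x.1) (z := fun i => (((n : ℝ) - 2) * ζ k) * ζ i)
    (fun i hi => by simpa only [mul_comm (ζ i), ← mul_assoc] using h.pair u v huv i hi k hk)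
    (by simp [pairCount, level_eq_zero, hζ.eq_zero]) hj
  have hdrift_right := abs_linDrift_sub_linDrift_le hlam hζ.share_nonneg (share_le_one ζ)
    (y := fun i => pairCount u v j i x.1) (z := fun i => (((n : ℝ) - 2) * ζ j) * ζ i)
    (fun i hi => by simpa only [← mul_assoc] using h.pair u v huv j hj i hi)
    (by simp [pairCount, level_eq_zero, hζ.eq_zero]) hk
  rw [linDrift_const_mul] at hdrift_left hdrift_right
  have hgen := abs_le.1 (h.abs_loadGen_pairCount_sub_linDrift_le hlam hn hζ huv hj hk)
  have hleft := abs_le.1 hdrift_left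
  have hright := abs_le.1 hdrift_right
  rw [abs_le]
  constructor <;> linarith

lemma indirectCount_add_single_sub (u v : Fin n) (x : Route n → ℕ) (r : Route n) :
    indirectCount u v (x + Pi.single r 1) - indirectCount u v x =
      if r ∈ indirect u v then 1 else 0 := by
  simp only [indirectCount, ← Finset.sum_sub_distrib, Pi.add_apply, Nat.cast_add,
    add_sub_cancel_left, Pi.single_apply]
  simp

lemma indirectCount_mono (u v : Fin n) : Monotone (indirectCount u v) := fun _ _ h =>
  Finset.sum_le_sum fun r _ => Nat.cast_le.2 (h r)

lemma loadGen_indirectCount_le (hlam : 0 ≤ lam) (x : Route n → ℕ) {u v : Fin n}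
    (huv : u ≠ v) : loadGen lam C (indirectCount u v) x ≤ lam :=
  calc loadGen lam C (indirectCount u v) x
      ≤ ∑ r, arrivalRate lam C x r * (if r ∈ indirect u v then 1 else 0) := by
        refine Finset.sum_le_sum fun r _ => ?_
        rw [indirectCount_add_single_sub]
        exact add_le_of_nonpos_right (mul_nonpos_of_nonneg_of_nonpos (Nat.cast_nonneg _)
          (sub_nonpos.2 (indirectCount_mono u v tsub_le_self)))
    _ = ∑ r ∈ indirect u v, arrivalRate lam C x r := by simp
    _ ≤ lam := sum_arrivalRate_indirect_le hlam x huv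

/-- A jump along the route `r` changes `g` by at most the number of links of `r` at `u` and `v`. -/
def JumpBound (u v : Fin n) (g : (Route n → ℕ) → ℝ) : Prop :=
  ∀ x r, |g (x + Pi.single r 1) - g x| ≤ degAt u r + degAt v r

lemma JumpBound.sub_single {u v : Fin n} {g : (Route n → ℕ) → ℝ} (h : JumpBound u v g)
    {x : Route n → ℕ} {r : Route n} (hr : x r ≠ 0) :
    |g (x - Pi.single r 1) - g x| ≤ degAt u r + degAt v r := by
  have hadd := h (x - Pi.single r 1) r
  rwa [sub_single_add_single hr, abs_sub_comm] at hadd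

lemma jumpBound_starCount (v : Fin n) (k : ℕ) : JumpBound v v (starCount v k) := fun x r =>
  calc |starCount v k (x + Pi.single r 1) - starCount v k x|
      ≤ degAt v r := by
        rw [starCount, starCount, ← Finset.sum_sub_distrib]
        exact (Finset.abs_sum_le_sum_abs _ _).trans
          (Finset.sum_le_sum fun w _ => abs_level_add_single_sub_le _ _ _ _)
    _ ≤ degAt v r + degAt v r := le_add_of_nonneg_left (degAt_nonneg v r)

lemma jumpBound_pairCount (u v : Fin n) (j k : ℕ) : JumpBound u v (pairCount u v j k) := by
  intro x r
  have hsub (p : Fin n → Prop) [DecidablePred p] (a : Fin n)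
      (hp : ∀ w, w ≠ u ∧ w ≠ v → p w) :
      ∑ w with w ≠ u ∧ w ≠ v, (if r.Uses s(a, w) then (1 : ℝ) else 0) ≤
        ∑ w with p w, if r.Uses s(a, w) then 1 else 0 :=
    Finset.sum_le_sum_of_subset_of_nonneg (Finset.monotone_filter_right _ fun w _ => hp w)
      fun _ _ _ => by split_ifs <;> simp
  rw [pairCount, pairCount, ← Finset.sum_sub_distrib]
  calc _ ≤ _ := Finset.abs_sum_le_sum_abs _ _
    _ ≤ ∑ w with w ≠ u ∧ w ≠ v, ((if r.Uses s(u, w) then (1 : ℝ) else 0) +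
          (if r.Uses s(v, w) then 1 else 0)) := by
        refine Finset.sum_le_sum fun w _ => ?_
        rw [show ∀ a b c d : ℝ, a * b - c * d = (a - c) * b + c * (b - d) from
          fun _ _ _ _ => by ring]
        exact (abs_mul_add_mul_le (level_nonneg _ _ _) (level_le_one _ _ _) (level_nonneg _ _ _)
          (level_le_one _ _ _)).trans (add_le_add (abs_level_add_single_sub_le _ _ _ _)
          (abs_level_add_single_sub_le _ _ _ _))
    _ ≤ degAt u r + degAt v r := by
        rw [Finset.sum_add_distrib]
        exact add_le_add (hsub _ u fun _ h => h.1) (hsub _ v fun _ h => h.2)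

lemma jumpBound_indirectCount (u v : Fin n) : JumpBound u v (indirectCount u v) := by
  intro x r
  have hu := degAt_nonneg u r
  have hv := degAt_nonneg v r
  rw [indirectCount_add_single_sub]
  split_ifs with h
  · rw [abs_one]
    linarith [one_le_degAt h]
  · rw [abs_zero]
    exact add_nonneg hu hv

lemma JumpBound.abs_sub_le {u v : Fin n} {g : (Route n → ℕ) → ℝ} (h : JumpBound u v g)
    {x y : State n C} (hxy : x ≠ y) (hq : generator n C lam x y ≠ 0) : |g y.1 - g x.1| ≤ 4 := by
  obtain ⟨r, hr⟩ := exists_single_of_generator_ne_zero hxy hq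
  have hjump : |g y.1 - g x.1| ≤ degAt u r + degAt v r := by
    obtain hr | ⟨hr₀, hr⟩ := hr <;> rw [hr]
    exacts [h x.1 r, h.sub_single hr₀]
  linarith [degAt_le_two u r, degAt_le_two v r]

lemma JumpBound.sum_generator_mul_sq_le {u v : Fin n} {g : (Route n → ℕ) → ℝ}
    (h : JumpBound u v g) (hlam : 0 ≤ lam) (x : State n C) :
    ∑ y, generator n C lam x y * (g y.1 - g x.1) ^ 2 ≤ 8 * n * (2 * lam + C) := by
  have hsq (r : Route n) (a : ℝ) (ha : |a| ≤ degAt u r + degAt v r) :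
      a ^ 2 ≤ 4 * (degAt u r + degAt v r) := by
    rw [← sq_abs]
    nlinarith [abs_nonneg a, degAt_le_two u r, degAt_le_two v r]
  calc ∑ y, generator n C lam x y * (g y.1 - g x.1) ^ 2
      = ∑ r, (arrivalRate lam C x.1 r * (g (x.1 + Pi.single r 1) - g x.1) ^ 2 +
          x.1 r * (g (x.1 - Pi.single r 1) - g x.1) ^ 2) :=
        sum_generator_mul x (ψ := fun y => (g y - g x.1) ^ 2) (by simp)
    _ ≤ ∑ r, (4 * ((arrivalRate lam C x.1 r + x.1 r) * degAt u r) +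
          4 * ((arrivalRate lam C x.1 r + x.1 r) * degAt v r)) := by
        refine Finset.sum_le_sum fun r _ => ?_
        have hjoin := mul_le_mul_of_nonneg_left (hsq r _ (h x.1 r))
          (arrivalRate_nonneg (C := C) hlam x.1 r)
        have hleave : (x.1 r : ℝ) * (g (x.1 - Pi.single r 1) - g x.1) ^ 2 ≤
            x.1 r * (4 * (degAt u r + degAt v r)) := by
          by_cases hr : x.1 r = 0
          · simp [hr]
          · exact mul_le_mul_of_nonneg_left (hsq r _ (h.sub_single hr)) (Nat.cast_nonneg _)
        linarith
    _ ≤ 8 * n * (2 * lam + C) := by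
        rw [Finset.sum_add_distrib, ← Finset.mul_sum, ← Finset.mul_sum]
        linarith [sum_rate_mul_degAt_le hlam x u, sum_rate_mul_degAt_le hlam x v]

end Drift

section Calculus

variable {E : Type*} [NormedAddCommGroup E] [NormedSpace ℝ E]

lemma hasDerivWithinAt_Ici_of_Icc {f : ℝ → E} {f' : E} {a b t : ℝ}
    (h : HasDerivWithinAt f f' (Icc a b) t) (ht : t ∈ Ico a b) :
    HasDerivWithinAt f f' (Ici t) t :=
  h.mono_of_mem_nhdsWithin (Icc_mem_nhdsGE_of_mem ht)

lemma nonneg_of_deriv_nonneg_of_nonpos {f f' : ℝ → ℝ} {T : ℝ}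
    (hf : ∀ t ∈ Icc 0 T, HasDerivWithinAt f (f' t) (Icc 0 T) t) (h0 : 0 ≤ f 0)
    (hf' : ∀ t ∈ Icc 0 T, f t ≤ 0 → 0 ≤ f' t) {t : ℝ} (ht : t ∈ Icc 0 T) : 0 ≤ f t := by
  have hbarrier (ε : ℝ) (hε : 0 < ε) : -f t ≤ ε * (1 + t) := by
    refine image_le_of_deriv_right_lt_deriv_boundary' (f := fun t => -f t)
      (f' := fun t => -f' t) (B := fun t => ε * (1 + t)) (B' := fun _ => ε)
      (fun s hs => (hf s hs).continuousWithinAt.neg)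
      (fun s hs => hasDerivWithinAt_Ici_of_Icc (hf s (Ico_subset_Icc_self hs)).neg hs)
      (by linarith) (by fun_prop) (fun s _ => ?_) (fun s hs heq => ?_) ht
    · simpa only [id, mul_one] using
        (((hasDerivAt_id s).const_add 1).const_mul ε).hasDerivWithinAt
    · have hpos : 0 < ε * (1 + s) := mul_pos hε (by linarith [hs.1])
      linarith [hf' s (Ico_subset_Icc_self hs) (by linarith)]
  have ht' : 0 < 1 + t := by linarith [ht.1]
  refine neg_nonpos.1 (le_of_forall_pos_le_add fun ε hε => ?_)
  rw [zero_add]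
  simpa only [div_mul_cancel₀ ε ht'.ne'] using hbarrier (ε / (1 + t)) (div_pos hε ht')

lemma norm_sub_sub_smul_le {ψ ψ' : ℝ → E} {a b ε : ℝ} {c : E} (hab : a ≤ b)
    (hψ : ∀ t ∈ Icc a b, HasDerivWithinAt ψ (ψ' t) (Icc a b) t)
    (hε : ∀ t ∈ Icc a b, ‖ψ' t - c‖ ≤ ε) : ‖ψ b - ψ a - (b - a) • c‖ ≤ (b - a) * ε := by
  have hderiv (t : ℝ) (ht : t ∈ Icc a b) :
      HasDerivWithinAt (fun s => ψ s - s • c) (ψ' t - c) (Icc a b) t := by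
    simpa only [one_smul] using
      (hψ t ht).fun_sub ((hasDerivAt_id' t).smul_const c).hasDerivWithinAt
  have hmvt := (convex_Icc a b).norm_image_sub_le_of_norm_hasDerivWithin_le hderiv hε
    (left_mem_Icc.2 hab) (right_mem_Icc.2 hab)
  rw [Real.norm_of_nonneg (sub_nonneg.2 hab), mul_comm, sub_sub_sub_comm, ← sub_smul] at hmvt
  exact hmvt

lemma eventually_norm_sub_euler_le {T : ℝ} {ψ ψ' : ℝ → E}
    (hψ : ∀ t ∈ Icc 0 T, HasDerivWithinAt ψ (ψ' t) (Icc 0 T) t) (hψ' : ContinuousOn ψ' (Icc 0 T))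
    {ε : ℝ} (hε : 0 < ε) :
    ∀ᶠ h in 𝓝[>] (0 : ℝ), ∀ i : ℕ, i * h ≤ T →
      ‖ψ (i * h) - ψ 0 - ∑ l ∈ Finset.range i, h • ψ' (l * h)‖ ≤ i * h * ε := by
  obtain ⟨δ, hδ, huc⟩ := Metric.uniformContinuousOn_iff.1
    (isCompact_Icc.uniformContinuousOn_of_continuous hψ') ε hε
  filter_upwards [Ioo_mem_nhdsGT hδ] with h hh i
  obtain ⟨h0, hhδ⟩ := hh
  induction i with
  | zero => simp
  | succ i ih =>
    intro hi
    rw [Nat.cast_succ, add_one_mul] at hi ⊢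
    have hih : 0 ≤ (i : ℝ) * h := by positivity
    have hsub : Icc ((i : ℝ) * h) (i * h + h) ⊆ Icc 0 T := Icc_subset_Icc hih hi
    have hstep : ‖ψ (i * h + h) - ψ (i * h) - h • ψ' (i * h)‖ ≤ h * ε := by
      have hle : (i : ℝ) * h ≤ i * h + h := by linarith
      have hosc (s : ℝ) (hs : s ∈ Icc ((i : ℝ) * h) (i * h + h)) : ‖ψ' s - ψ' (i * h)‖ ≤ ε := by
        rw [← dist_eq_norm]
        refine (huc s (hsub hs) _ (hsub (left_mem_Icc.2 hle)) ?_).le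
        rw [Real.dist_eq, abs_of_nonneg (sub_nonneg.2 hs.1)]
        linarith [hs.2]
      simpa only [add_sub_cancel_left] using
        norm_sub_sub_smul_le hle (fun s hs => (hψ s (hsub hs)).mono hsub) hosc
    have hsplit : ψ (i * h + h) - ψ 0 - (∑ l ∈ Finset.range i, h • ψ' (l * h) + h • ψ' (i * h)) =
        (ψ (i * h) - ψ 0 - ∑ l ∈ Finset.range i, h • ψ' (l * h)) +
          (ψ (i * h + h) - ψ (i * h) - h • ψ' (i * h)) := by abel
    rw [Finset.sum_range_succ, hsplit, add_mul]
    exact norm_add_le_of_le (ih (by linarith)) hstep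

end Calculus

section Solution

variable {C : ℕ} {lam t₀ : ℝ} {ξ₀ : Fin (C + 1) → ℝ}

/-- The extension of `ξ` by zero to all loads. -/
def profile (ξ : Fin (C + 1) → ℝ) (k : ℕ) : ℝ := if h : k < C + 1 then ξ ⟨k, h⟩ else 0

lemma profile_coe (ξ : Fin (C + 1) → ℝ) (k : Fin (C + 1)) : profile ξ k = ξ k :=
  dif_pos k.isLt

lemma profile_eq_zero (ξ : Fin (C + 1) → ℝ) {k : ℕ} (hk : C < k) : profile ξ k = 0 :=
  dif_neg (Nat.not_lt.2 hk)

lemma isProfile_profile {ξ : Fin (C + 1) → ℝ} (h : ξ ∈ stdSimplex ℝ (Fin (C + 1))) :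
    IsProfile C (profile ξ) where
  nonneg k := by
    unfold profile
    split_ifs
    exacts [h.1 _, le_rfl]
  le_one k := by
    unfold profile
    split_ifs
    exacts [(mem_Icc_of_mem_stdSimplex h _).2, zero_le_one]
  eq_zero _ := profile_eq_zero ξ

lemma drift_eq_linDrift (ξ : Fin (C + 1) → ℝ) (k : Fin (C + 1)) :
    drift C lam ξ k = linDrift lam C (share C (profile ξ)) (profile ξ) k := by
  obtain ⟨k, hk⟩ := k
  have hlast : profile ξ C = ξ (Fin.last C) := profile_coe ξ (Fin.last C)
  have hpred : k - 1 < C + 1 := by omega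
  simp only [drift, linDrift, share, altRate, hlast]
  simp only [profile, hk, hpred, dif_pos, Nat.add_lt_add_iff_right]
  split_ifs <;> ring

lemma sum_linDrift (c : ℝ) {y : ℕ → ℝ} (hy : y (C + 1) = 0) :
    ∑ k ∈ Finset.range (C + 1), linDrift lam C c y k = 0 := by
  have hin : ∑ k ∈ Finset.range (C + 1), (if 0 < k then y (k - 1) else 0) =
      ∑ k ∈ Finset.range C, y k := by
    rw [Finset.sum_range_succ']
    simp
  have hout : ∑ k ∈ Finset.range (C + 1), (if k < C then y k else 0) =
      ∑ k ∈ Finset.range C, y k := by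
    rw [Finset.sum_range_succ, if_neg (lt_irrefl C), add_zero]
    exact Finset.sum_congr rfl fun k hk => if_pos (Finset.mem_range.1 hk)
  have hdepart : ∑ k ∈ Finset.range (C + 1), (((k : ℝ) + 1) * y (k + 1) - k * y k) = 0 := by
    simpa [hy] using Finset.sum_range_sub (fun k : ℕ => (k : ℝ) * y k) (C + 1)
  simp only [linDrift, add_sub_assoc]
  rw [Finset.sum_add_distrib, ← Finset.mul_sum, Finset.sum_sub_distrib, hin, hout, hdepart,
    sub_self, mul_zero, add_zero]

lemma sum_drift (ξ : Fin (C + 1) → ℝ) : ∑ k, drift C lam ξ k = 0 := by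
  simp only [drift_eq_linDrift]
  rw [Fin.sum_univ_eq_sum_range (linDrift lam C (share C (profile ξ)) (profile ξ))]
  exact sum_linDrift _ (profile_eq_zero ξ (Nat.lt_succ_self C))

lemma drift_nonneg_of_eq_zero (hlam : 0 ≤ lam) {ξ : Fin (C + 1) → ℝ} (h0 : ∀ k, 0 ≤ ξ k)
    (h1 : ∀ k, ξ k ≤ 1) {k : Fin (C + 1)} (hk : ξ k = 0) : 0 ≤ drift C lam ξ k := by
  have halt (j : Fin (C + 1)) : 0 ≤ altRate ξ j :=
    mul_nonneg (mul_nonneg (mul_nonneg zero_le_two (h0 _)) (sub_nonneg.2 (h1 _))) (h0 j)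
  have halt_zero : altRate ξ k = 0 := by rw [altRate, hk, mul_zero]
  unfold drift
  rw [hk, halt_zero]
  simp only [mul_zero, neg_zero, sub_zero, zero_add]
  refine add_nonneg ?_ ?_ <;> split_ifs
  · exact add_nonneg (mul_nonneg hlam (h0 _)) (mul_nonneg hlam (halt _))
  · exact le_rfl
  · exact mul_nonneg (by positivity) (h0 _)
  · exact le_rfl

lemma contDiff_drift : ContDiff ℝ 1 (drift C lam) := by
  refine contDiff_pi.2 fun k => ?_
  unfold drift altRate
  split_ifs <;> fun_prop

/-- The projection onto the unit cube, which makes the vector field globally Lipschitz. -/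
def clamp (ξ : Fin (C + 1) → ℝ) : Fin (C + 1) → ℝ := 0 ⊔ 1 ⊓ ξ

lemma clamp_mem_Icc (ξ : Fin (C + 1) → ℝ) : clamp ξ ∈ Icc 0 1 :=
  ⟨le_sup_left, sup_le zero_le_one inf_le_left⟩

lemma clamp_eq_self {ξ : Fin (C + 1) → ℝ} (h : ξ ∈ Icc 0 1) : clamp ξ = ξ := by
  rw [clamp, inf_eq_right.2 h.2, sup_eq_right.2 h.1]

lemma clamp_apply_eq_zero {ξ : Fin (C + 1) → ℝ} {k : Fin (C + 1)} (h : ξ k ≤ 0) :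
    clamp ξ k = 0 :=
  max_eq_left ((min_le_right _ _).trans h)

lemma lipschitzWith_clamp : LipschitzWith 1 (clamp (C := C)) :=
  LipschitzWith.of_dist_le_mul fun ξ η => (dist_pi_le_iff (by positivity)).2 fun k =>
    (((LipschitzWith.eval k).const_min 1).const_max 0).dist_le_mul ξ η

lemma exists_lipschitzWith_drift_clamp :
    ∃ K L : ℝ≥0, LipschitzWith K (fun ξ => drift C lam (clamp ξ)) ∧
      ∀ ξ, ‖drift C lam (clamp ξ)‖ ≤ L := by
  have hcube : IsCompact (Icc (0 : Fin (C + 1) → ℝ) 1) := isCompact_Icc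
  have hdiff : ContDiff ℝ 1 (drift C lam) := contDiff_drift
  obtain ⟨K, hK⟩ := hdiff.contDiffOn.exists_lipschitzOnWith one_ne_zero (convex_Icc _ _) hcube
  obtain ⟨L, hL⟩ := hcube.exists_bound_of_continuousOn hdiff.continuous.continuousOn
  refine ⟨K, L.toNNReal, ?_, fun ξ => (hL _ (clamp_mem_Icc ξ)).trans (Real.le_coe_toNNReal L)⟩
  rw [← mul_one K, ← lipschitzOnWith_univ]
  exact hK.comp lipschitzWith_clamp.lipschitzOnWith fun ξ _ => clamp_mem_Icc ξ

lemma exists_isSolution_clamp (ht₀ : 0 ≤ t₀) (ξ₀ : Fin (C + 1) → ℝ) :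
    ∃ ξ : ℝ → Fin (C + 1) → ℝ, ξ 0 = ξ₀ ∧
      ∀ t ∈ Icc 0 t₀, HasDerivWithinAt ξ (drift C lam (clamp (ξ t))) (Icc 0 t₀) t := by
  obtain ⟨K, L, hK, hL⟩ := exists_lipschitzWith_drift_clamp (C := C) (lam := lam)
  have hpl : IsPicardLindelof (fun _ ξ => drift C lam (clamp ξ)) (tmin := 0) (tmax := t₀)
      ⟨0, le_rfl, ht₀⟩ ξ₀ (L * t₀.toNNReal) 0 L K :=
    { lipschitzOnWith := fun _ _ => hK.lipschitzOnWith
      continuousOn := fun _ _ => continuousOn_const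
      norm_le := fun _ _ ξ _ => hL ξ
      mul_max_le := by simp [ht₀] }
  exact hpl.exists_eq_forall_mem_Icc_hasDerivWithinAt₀

lemma exists_isSolution (hlam : 0 ≤ lam) (ht₀ : 0 ≤ t₀) (hξ₀ : ξ₀ ∈ stdSimplex ℝ (Fin (C + 1))) :
    ∃ ξ, IsSolution C lam t₀ ξ₀ ξ ∧ ∀ t ∈ Icc 0 t₀, ξ t ∈ stdSimplex ℝ (Fin (C + 1)) := by
  obtain ⟨ξ, h0, hξ⟩ := exists_isSolution_clamp (lam := lam) ht₀ ξ₀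
  have hderiv (k : Fin (C + 1)) (t : ℝ) (ht : t ∈ Icc 0 t₀) :
      HasDerivWithinAt (fun t => ξ t k) (drift C lam (clamp (ξ t)) k) (Icc 0 t₀) t :=
    hasDerivWithinAt_pi.1 (hξ t ht) k
  have hnonneg (t : ℝ) (ht : t ∈ Icc 0 t₀) (k : Fin (C + 1)) : 0 ≤ ξ t k :=
    nonneg_of_deriv_nonneg_of_nonpos (hderiv k) (h0 ▸ hξ₀.1 k) (fun s _ hs =>
      drift_nonneg_of_eq_zero hlam (clamp_mem_Icc (ξ s)).1 (clamp_mem_Icc (ξ s)).2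
        (clamp_apply_eq_zero hs)) ht
  have hsum (t : ℝ) (ht : t ∈ Icc 0 t₀) : ∑ k, ξ t k = 1 := by
    have hsum_deriv (s : ℝ) (hs : s ∈ Icc 0 t₀) :
        HasDerivWithinAt (fun t => ∑ k, ξ t k) 0 (Icc 0 t₀) s := by
      simpa only [sum_drift] using
        HasDerivWithinAt.fun_sum (u := Finset.univ) fun k _ => hderiv k s hs
    have hconst := constant_of_has_deriv_right_zero (f := fun t => ∑ k, ξ t k)
      (fun s hs => (hsum_deriv s hs).continuousWithinAt)
      (fun s hs => hasDerivWithinAt_Ici_of_Icc (hsum_deriv s (Ico_subset_Icc_self hs)) hs) t ht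
    rw [hconst, h0, hξ₀.2]
  have hmem (t : ℝ) (ht : t ∈ Icc 0 t₀) : ξ t ∈ stdSimplex ℝ (Fin (C + 1)) :=
    ⟨hnonneg t ht, hsum t ht⟩
  refine ⟨ξ, ⟨h0, fun t ht => ?_⟩, hmem⟩
  have hcube : ξ t ∈ Icc 0 1 :=
    ⟨fun k => (mem_Icc_of_mem_stdSimplex (hmem t ht) k).1,
      fun k => (mem_Icc_of_mem_stdSimplex (hmem t ht) k).2⟩
  simpa only [clamp_eq_self hcube] using hξ t ht

lemma IsSolution.continuousOn {ξ : ℝ → Fin (C + 1) → ℝ} (h : IsSolution C lam t₀ ξ₀ ξ) :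
    ContinuousOn ξ (Icc 0 t₀) :=
  fun t ht => (h.2 t ht).continuousWithinAt

lemma IsSolution.eqOn {ξ η : ℝ → Fin (C + 1) → ℝ} (hη : IsSolution C lam t₀ ξ₀ η)
    (hξ : IsSolution C lam t₀ ξ₀ ξ) : EqOn η ξ (Icc 0 t₀) := by
  obtain ⟨R, hR⟩ := isCompact_Icc.exists_bound_of_continuousOn hη.continuousOn
  obtain ⟨R', hR'⟩ := isCompact_Icc.exists_bound_of_continuousOn hξ.continuousOn
  have hdiff : ContDiff ℝ 1 (drift C lam) := contDiff_drift
  obtain ⟨K, hK⟩ := hdiff.contDiffOn.exists_lipschitzOnWith one_ne_zero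
    (convex_closedBall 0 (max R R')) (isCompact_closedBall _ _)
  have hright {ζ : ℝ → Fin (C + 1) → ℝ} (hζ : IsSolution C lam t₀ ξ₀ ζ) (t : ℝ)
      (ht : t ∈ Ico 0 t₀) : HasDerivWithinAt ζ (drift C lam (ζ t)) (Ici t) t :=
    hasDerivWithinAt_Ici_of_Icc (hζ.2 t (Ico_subset_Icc_self ht)) ht
  exact ODE_solution_unique_of_mem_Icc_right (v := fun _ => drift C lam)
    (s := fun _ => Metric.closedBall 0 (max R R')) (fun _ _ => hK)
    hη.continuousOn (hright hη)
    (fun t ht => mem_closedBall_zero_iff.2 (le_max_of_le_left (hR t (Ico_subset_Icc_self ht))))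
    hξ.continuousOn (hright hξ)
    (fun t ht => mem_closedBall_zero_iff.2 (le_max_of_le_right (hR' t (Ico_subset_Icc_self ht))))
    (hη.1.trans hξ.1.symm)

end Solution

section Observables

variable {n C : ℕ} {lam : ℝ}

/-- The indices of the statistics of the network that the argument follows: `starCount v k`,
`pairCount u v j k` and `indirectCount u v`. -/
abbrev Observable (n C : ℕ) : Type :=
  (Fin n × Fin (C + 1)) ⊕ (Fin n × Fin n × Fin (C + 1) × Fin (C + 1)) ⊕ (Fin n × Fin n)

/-- The statistic with a given index. -/
def obs : Observable n C → (Route n → ℕ) → ℝ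
  | .inl (v, k) => starCount v k
  | .inr (.inl (u, v, j, k)) => pairCount u v j k
  | .inr (.inr (u, v)) => indirectCount u v

lemma exists_jumpBound_obs (o : Observable n C) : ∃ u v, JumpBound u v (obs o) := by
  rcases o with ⟨v, k⟩ | ⟨u, v, j, k⟩ | ⟨u, v⟩
  exacts [⟨v, v, jumpBound_starCount v k⟩, ⟨u, v, jumpBound_pairCount u v j k⟩,
    ⟨u, v, jumpBound_indirectCount u v⟩]

lemma card_observable_le (n C : ℕ) :
    (Fintype.card (Observable n C) : ℝ) ≤ 3 * n ^ 2 * ((C : ℝ) + 1) ^ 2 := by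
  simp only [Observable, Fintype.card_sum, Fintype.card_prod, Fintype.card_fin]
  have hn : n ≤ n ^ 2 := Nat.le_self_pow two_ne_zero n
  have hC : C + 1 ≤ (C + 1) ^ 2 := Nat.le_self_pow two_ne_zero (C + 1)
  have hstar : n * (C + 1) ≤ n ^ 2 * (C + 1) ^ 2 := Nat.mul_le_mul hn hC
  have hindirect : n ^ 2 ≤ n ^ 2 * (C + 1) ^ 2 := Nat.le_mul_of_pos_right _ (by positivity)
  have hcard : n * (C + 1) + (n * (n * ((C + 1) * (C + 1))) + n * n) ≤
      3 * n ^ 2 * (C + 1) ^ 2 := by linarith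
  exact_mod_cast hcard

/-- The deviation of the sequence `F` from the Euler scheme with step length `h` and slopes `G`. -/
def eulerError (h : ℝ) (F G : ℕ → ℝ) (i : ℕ) : ℝ := F i - F 0 - ∑ l ∈ Finset.range i, h * G l

lemma eulerError_const_mul (h c : ℝ) (F G : ℕ → ℝ) (i : ℕ) :
    eulerError h (fun l => c * F l) (fun l => c * G l) i = c * eulerError h F G i := by
  simp only [eulerError, mul_sub, Finset.mul_sum, mul_left_comm h c]

/-- The martingale part of the statistic `g` along the path `x` of the chain sampled at times
`0, h, 2 h, …`, up to the discretization of its drift. -/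
def martingalePart (lam h : ℝ) (g : (Route n → ℕ) → ℝ) (x : ℕ → State n C) : ℕ → ℝ :=
  eulerError h (fun l => g (x l).1) fun l => loadGen lam C g (x l).1

/-- The martingale parts of all statistics stay below `a` along the first `N` steps of `x`. -/
def IsTypical (lam h : ℝ) (N : ℕ) (a : ℝ) (x : ℕ → State n C) : Prop :=
  ∀ o : Observable n C, ∀ i ≤ N, |martingalePart lam h (obs o) x i| ≤ a

end Observables

section Gronwall

variable {n C : ℕ} {lam h : ℝ}

lemma abs_sub_le_of_abs_eulerError_le {F m G D E : ℕ → ℝ} {a b c p q : ℝ} {i : ℕ} (hh : 0 ≤ h)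
    (hF : |eulerError h F G i| ≤ a) (hm : |eulerError h m D i| ≤ c) (hb : |F 0 - m 0| ≤ b)
    (hGD : ∀ l < i, |G l - D l| ≤ p * E l + q) :
    |F i - m i| ≤ a + c + b + p * ∑ l ∈ Finset.range i, h * E l + i * h * q := by
  have hsum : |∑ l ∈ Finset.range i, h * (G l - D l)| ≤
      p * ∑ l ∈ Finset.range i, h * E l + i * h * q :=
    calc _ ≤ ∑ l ∈ Finset.range i, (p * (h * E l) + h * q) := by
          refine (Finset.abs_sum_le_sum_abs _ _).trans (Finset.sum_le_sum fun l hl => ?_)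
          rw [abs_mul, abs_of_nonneg hh, mul_left_comm p, ← mul_add]
          exact mul_le_mul_of_nonneg_left (hGD l (Finset.mem_range.1 hl)) hh
      _ = _ := by
          rw [Finset.sum_add_distrib, ← Finset.mul_sum, Finset.sum_const, Finset.card_range,
            nsmul_eq_mul, mul_assoc]
  have hsplit : F i - m i = eulerError h F G i - eulerError h m D i + (F 0 - m 0) +
      ∑ l ∈ Finset.range i, h * (G l - D l) := by
    simp only [eulerError, mul_sub, Finset.sum_sub_distrib]
    ring
  rw [hsplit, add_assoc (a + c + b)]
  exact (abs_add_le _ _).trans (add_le_add ((abs_add_le _ _).trans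
    (add_le_add ((abs_sub _ _).trans (add_le_add hF hm)) hb)) hsum)

lemma indirectCount_le_add_of_abs_martingalePart_le (hlam : 0 ≤ lam) (hh : 0 ≤ h) {u v : Fin n}
    (huv : u ≠ v) {x : ℕ → State n C} {a : ℝ} {i : ℕ}
    (hx : |martingalePart lam h (indirectCount u v) x i| ≤ a) :
    indirectCount u v (x i).1 ≤ indirectCount u v (x 0).1 + a + lam * (i * h) := by
  have hdrift : ∑ l ∈ Finset.range i, h * loadGen lam C (indirectCount u v) (x l).1 ≤
      lam * (i * h) := by
    refine (Finset.sum_le_card_nsmul _ _ (h * lam) fun l _ =>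
      mul_le_mul_of_nonneg_left (loadGen_indirectCount_le hlam _ huv) hh).trans_eq ?_
    rw [Finset.card_range, nsmul_eq_mul]
    ring
  have hdev := (le_abs_self _).trans hx
  simp only [martingalePart, eulerError] at hdev
  linarith

/-- The sequence `ζ` of profiles follows the limiting equation, and so do the products of its
entries, in `N` Euler steps of length `h` up to an error of `1 / n`. -/
structure IsEulerPath (n C : ℕ) (lam h : ℝ) (N : ℕ) (ζ : ℕ → ℕ → ℝ) : Prop where
  isProfile : ∀ i ≤ N, IsProfile C (ζ i)
  single : ∀ k ≤ C, ∀ i ≤ N,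
    n * |eulerError h (fun l => ζ l k) (fun l => linDrift lam C (share C (ζ l)) (ζ l) k) i| ≤ 1
  pair : ∀ j ≤ C, ∀ k ≤ C, ∀ i ≤ N,
    n * |eulerError h (fun l => ζ l j * ζ l k) (fun l =>
      linDrift lam C (share C (ζ l)) (ζ l) j * ζ l k +
        ζ l j * linDrift lam C (share C (ζ l)) (ζ l) k) i| ≤ 1

lemma abs_eulerError_const_mul_le {F G : ℕ → ℝ} {a c : ℝ} {i : ℕ} (hc : 0 ≤ c) (hcn : c ≤ n)
    (hF : n * |eulerError h F G i| ≤ a) :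
    |eulerError h (fun l => c * F l) (fun l => c * G l) i| ≤ a := by
  rw [eulerError_const_mul, abs_mul, abs_of_nonneg hc]
  exact (mul_le_mul_of_nonneg_right hcn (abs_nonneg _)).trans hF

/-- The growth rate of the deviation from the limiting equation. -/
def growth (lam : ℝ) (C : ℕ) : ℝ := 16 * lam + 4 * C + 3

lemma growth_pos (hlam : 0 ≤ lam) : 0 < growth lam C := by
  unfold growth
  positivity

lemma closeTo_step (hlam : 0 ≤ lam) (hn : 2 < n) (hh : 0 ≤ h) {a E₀ T : ℝ} {i N : ℕ}
    (hiN : i ≤ N) (hT : N * h ≤ T) {x : ℕ → State n C} {ζ : ℕ → ℕ → ℝ}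
    (hζ : IsEulerPath n C lam h N ζ)
    (hmart : ∀ o : Observable n C, |martingalePart lam h (obs o) x i| ≤ a)
    (hE₀ : CloseTo C (ζ 0) E₀ (x 0).1) {E : ℕ → ℝ} (hE : ∀ l < i, 0 ≤ E l)
    (hclose : ∀ l < i, CloseTo C (ζ l) (E l) (x l).1) :
    CloseTo C (ζ i) (a + 1 + E₀ + 4 * lam * T +
      growth lam C * ∑ l ∈ Finset.range i, h * E l) (x i).1 := by
  have hn' : (2 : ℝ) < n := by exact_mod_cast hn
  have hiT : (i : ℝ) * h ≤ T :=
    (mul_le_mul_of_nonneg_right (by exact_mod_cast hiN) hh).trans hT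
  have ha : 0 ≤ a := (abs_nonneg _).trans (hmart (.inl (⟨0, by omega⟩, 0)))
  have hprofile (l : ℕ) (hl : l < i) : IsProfile C (ζ l) := hζ.isProfile l (hl.le.trans hiN)
  set Z := ∑ l ∈ Finset.range i, h * E l with hZ
  have hZ₀ : 0 ≤ Z := Finset.sum_nonneg fun l hl => mul_nonneg hh (hE l (Finset.mem_range.1 hl))
  have hlamZ : 0 ≤ lam * Z := mul_nonneg hlam hZ₀
  have hCZ : 0 ≤ C * Z := mul_nonneg C.cast_nonneg hZ₀
  have hlamT : lam * (i * h) ≤ lam * T := mul_le_mul_of_nonneg_left hiT hlam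
  have hlami : 0 ≤ lam * (i * h) := by positivity
  simp only [growth]
  refine ⟨fun v k hk => ?_, fun u v huv j hj k hk => ?_, fun u v huv => ?_⟩
  · have hdev := abs_sub_le_of_abs_eulerError_le hh (hmart (.inl (v, ⟨k, by omega⟩)))
      (abs_eulerError_const_mul_le (by linarith) (by linarith) (hζ.single k hk i hiN))
      (hE₀.star v k hk)
      fun l hl => (hclose l hl).abs_loadGen_starCount_sub_le hlam hn (hprofile l hl) v hk
    rw [← hZ] at hdev
    refine hdev.trans ?_
    linarith
  · have hdev := abs_sub_le_of_abs_eulerError_le hh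
      (hmart (.inr (.inl (u, v, ⟨j, by omega⟩, ⟨k, by omega⟩))))
      (abs_eulerError_const_mul_le (by linarith) (by linarith) (hζ.pair j hj k hk i hiN))
      (hE₀.pair u v huv j hj k hk)
      fun l hl => (hclose l hl).abs_loadGen_pairCount_sub_le hlam hn (hprofile l hl) huv hj hk
    rw [← hZ] at hdev
    refine hdev.trans ?_
    linarith
  · linarith [hE₀.indirect_le u v huv,
      indirectCount_le_add_of_abs_martingalePart_le hlam hh huv (hmart (.inr (.inr (u, v))))]

lemma sum_mul_geom (h L K : ℝ) (i : ℕ) :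
    L * ∑ l ∈ Finset.range i, h * (K * (1 + h * L) ^ l) = K * (1 + h * L) ^ i - K := by
  have hgeom := mul_geom_sum (1 + h * L) i
  rw [add_sub_cancel_left] at hgeom
  calc L * ∑ l ∈ Finset.range i, h * (K * (1 + h * L) ^ l)
      = K * (h * L * ∑ l ∈ Finset.range i, (1 + h * L) ^ l) := by
        simp only [← mul_assoc, ← Finset.mul_sum]
        ring
    _ = K * (1 + h * L) ^ i - K := by rw [hgeom, mul_sub, mul_one]

lemma IsTypical.closeTo (hlam : 0 ≤ lam) (hn : 2 < n) (hh : 0 ≤ h) {a E₀ T : ℝ} {N : ℕ}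
    (hT : N * h ≤ T) {x : ℕ → State n C} {ζ : ℕ → ℕ → ℝ} (hζ : IsEulerPath n C lam h N ζ)
    (hx : IsTypical lam h N a x) (hE₀ : CloseTo C (ζ 0) E₀ (x 0).1)
    {i : ℕ} (hi : i ≤ N) :
    CloseTo C (ζ i) ((a + 1 + E₀ + 4 * lam * T) * (1 + h * growth lam C) ^ i) (x i).1 := by
  have hT₀ : 0 ≤ T := (mul_nonneg N.cast_nonneg hh).trans hT
  have ha : 0 ≤ a := (abs_nonneg _).trans (hx (.inl (⟨0, by omega⟩, 0)) 0 N.zero_le)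
  have hE₀' : 0 ≤ E₀ := (abs_nonneg _).trans (hE₀.star ⟨0, by omega⟩ 0 (Nat.zero_le _))
  have hgrowth : 0 < growth lam C := growth_pos hlam
  induction i using Nat.strong_induction_on with
  | _ i ih =>
    have hstep := closeTo_step hlam hn hh hi hT hζ (fun o => hx o i hi) hE₀
      (E := fun l => (a + 1 + E₀ + 4 * lam * T) * (1 + h * growth lam C) ^ l)
      (fun l _ => by positivity) fun l hl => ih l hl (hl.le.trans hi)
    rwa [sum_mul_geom, add_sub_cancel] at hstep

end Gronwall

section InitialState

variable {n C : ℕ}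

lemma starCount_eq_numLinks (x : Route n → ℕ) (v : Fin n) (k : ℕ) :
    starCount v k x = numLinks x v k := by
  simp only [starCount, numLinks, level]
  rw [Finset.sum_boole, Finset.filter_filter]

lemma ind_eq_level (x : Route n → ℕ) {u w : Fin n} (h : u ≠ w) (k : ℕ) :
    ind x u w k = level x s(u, w) k := by
  simp [ind, level, h]

lemma ind_self (x : Route n → ℕ) (u : Fin n) (k : ℕ) : ind x u u k = 0 := by
  simp [ind]

lemma sum_ind_mul_ind (x : Route n → ℕ) (u v : Fin n) (j k : ℕ) :
    ∑ w, ind x u w j * ind x v w k = pairCount u v j k x := by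
  rw [pairCount, Finset.sum_filter]
  refine Finset.sum_congr rfl fun w _ => ?_
  split_ifs with h
  · rw [ind_eq_level x h.1.symm, ind_eq_level x h.2.symm]
  · rcases not_and_or.1 h with hw | hw <;> rw [not_not.1 hw, ind_self]
    exacts [zero_mul _, mul_zero _]

lemma sum_ind_others (x : Route n → ℕ) {u v : Fin n} (h : u ≠ v) (k : ℕ) :
    ∑ w with w ≠ u ∧ w ≠ v, ind x u w k = starCount u k x - level x s(u, v) k := by
  rw [← sum_level_others x h.symm]
  exact Finset.sum_congr rfl fun _ hw => ind_eq_level x (Finset.mem_filter.1 hw).2.1.symm k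

lemma phi1_le_phi (x : Route n → ℕ) : phi1 C x ≤ phi C x := le_max_left _ _

lemma phi3_le_phi (x : Route n → ℕ) : phi3 x ≤ phi C x :=
  (le_max_right _ _).trans (le_max_right _ _)

lemma phi_nonneg (hn : 2 < n) (x : Route n → ℕ) : 0 ≤ phi C x := by
  have hn' : (2 : ℝ) < n := by exact_mod_cast hn
  exact (Real.iSup_nonneg fun _ => mul_nonneg (one_div_nonneg.2 (by linarith))
    (Nat.cast_nonneg _)).trans (phi3_le_phi x)

lemma indirectCount_le_mul_phi (hn : 2 < n) (x : Route n → ℕ) {u v : Fin n} (huv : u ≠ v) :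
    indirectCount u v x ≤ n * phi C x := by
  have hn' : (0 : ℝ) < n - 2 := sub_pos.2 (by exact_mod_cast hn)
  have hphi : 1 / ((n : ℝ) - 2) * indirectCount u v x ≤ phi3 x := by
    refine le_of_eq_of_le ?_ (le_ciSup (Set.finite_range _).bddAbove (⟨(u, v), huv⟩ : Pairs n))
    rw [indirectCount, indirect, Nat.cast_sum]
  rw [one_div, inv_mul_le_iff₀ hn'] at hphi
  exact hphi.trans (mul_le_mul (by linarith) (phi3_le_phi x)
    (Real.iSup_nonneg fun _ => by positivity) n.cast_nonneg)

lemma abs_pairCount_sub_le_mul_phi (hn : 2 < n) (x : Route n → ℕ) {u v : Fin n} (huv : u ≠ v)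
    {j k : ℕ} (hj : j ≤ C) (hk : k ≤ C) :
    |pairCount u v j k x - (starCount u j x - level x s(u, v) j) *
      (starCount v k x - level x s(v, u) k) / ((n : ℝ) - 2)| ≤ n * phi C x := by
  have hn' : (0 : ℝ) < n - 2 := sub_pos.2 (by exact_mod_cast hn)
  have hphi : |1 / ((n : ℝ) - 2) * pairCount u v j k x - 1 / ((n : ℝ) - 2) ^ 2 *
      ((starCount u j x - level x s(u, v) j) * (starCount v k x - level x s(v, u) k))| ≤
      phi C x := by
    refine le_trans (le_of_eq_of_le ?_ (le_ciSup (Set.finite_range _).bddAbove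
      (⟨⟨(u, v), huv⟩, ⟨j, by omega⟩, ⟨k, by omega⟩⟩ : Pairs n × Fin (C + 1) × Fin (C + 1))))
      (phi1_le_phi x)
    simp only [sum_ind_mul_ind, sum_ind_others x huv]
    simp only [and_comm (b := _ ≠ v), sum_ind_others x huv.symm]
  have hscale (p q : ℝ) : p - q / ((n : ℝ) - 2) =
      ((n : ℝ) - 2) * (1 / ((n : ℝ) - 2) * p - 1 / ((n : ℝ) - 2) ^ 2 * q) := by
    field_simp
  rw [hscale, abs_mul, abs_of_pos hn']
  exact mul_le_mul (by linarith) hphi (abs_nonneg _) n.cast_nonneg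

lemma abs_mul_div_sub_le {p q c s t A : ℝ} (hc : 0 < c) (hq₀ : 0 ≤ q) (hqc : q ≤ c)
    (hs₀ : 0 ≤ s) (hs₁ : s ≤ 1) (hp : |p - c * s| ≤ A) (hq : |q - c * t| ≤ A) :
    |p * q / c - c * (s * t)| ≤ 2 * A := by
  have hsplit : p * q / c - c * (s * t) = (p - c * s) * (q / c) + s * (q - c * t) := by
    field_simp
    ring
  rw [hsplit, two_mul]
  exact (abs_mul_add_mul_le (div_nonneg hq₀ hc.le) ((div_le_one hc).2 hqc) hs₀ hs₁).trans
    (add_le_add hp hq)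

lemma closeTo_initial (hn : 2 < n) (x : Route n → ℕ) {ζ : ℕ → ℝ} (hζ : IsProfile C ζ) {A : ℝ}
    (hA : ∀ v, ∀ k ≤ C, |starCount v k x - ((n : ℝ) - 1) * ζ k| ≤ A) :
    CloseTo C ζ (A + n * phi C x + 1) x := by
  have hn' : (0 : ℝ) < n - 2 := sub_pos.2 (by exact_mod_cast hn)
  have hφ : 0 ≤ n * phi C x := mul_nonneg n.cast_nonneg (phi_nonneg hn x)
  have hA₀ : 0 ≤ A := (abs_nonneg _).trans (hA ⟨0, by omega⟩ 0 (Nat.zero_le _))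
  have hothers (u v : Fin n) (j : ℕ) (hj : j ≤ C) :
      |starCount u j x - level x s(u, v) j - ((n : ℝ) - 2) * ζ j| ≤ A + 1 := by
    have hstar := abs_le.1 (hA u j hj)
    rw [abs_le]
    constructor <;> linarith [hζ.nonneg j, hζ.le_one j, level_nonneg x s(u, v) j,
      level_le_one x s(u, v) j]
  refine ⟨fun v k hk => (hA v k hk).trans (by linarith), fun u v huv j hj k hk => ?_,
    fun u v huv => (indirectCount_le_mul_phi (C := C) hn x huv).trans (by linarith)⟩
  have hbound : starCount v k x - level x s(v, u) k ∈ Icc 0 ((n : ℝ) - 2) := by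
    rw [← sum_level_others x huv, ← card_others huv.symm, ← nsmul_one]
    exact ⟨Finset.sum_nonneg fun _ _ => level_nonneg _ _ _,
      Finset.sum_le_card_nsmul _ _ 1 fun _ _ => level_le_one _ _ _⟩
  calc _ ≤ n * phi C x + 2 * (A + 1) := (abs_sub_le _ _ _).trans
        (add_le_add (abs_pairCount_sub_le_mul_phi hn x huv hj hk)
          (abs_mul_div_sub_le hn' hbound.1 hbound.2 (hζ.nonneg j) (hζ.le_one j)
            (hothers u v j hj) (hothers v u k hk)))
    _ ≤ 2 * (A + n * phi C x + 1) := by linarith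

end InitialState

section Grid

variable {n C : ℕ} {lam t₀ : ℝ}

/-- The `i`-th point of the grid that divides `[0, t₀]` into `2 ^ m` intervals. -/
def gridTime (t₀ : ℝ) (m i : ℕ) : ℝ≥0 := i * (t₀.toNNReal / 2 ^ m)

lemma coe_gridTime (ht₀ : 0 ≤ t₀) (m i : ℕ) : (gridTime t₀ m i : ℝ) = i * (t₀ / 2 ^ m) := by
  simp [gridTime, ht₀]

lemma gridTime_zero (t₀ : ℝ) (m : ℕ) : gridTime t₀ m 0 = 0 := by
  simp [gridTime]

lemma monotone_gridTime (t₀ : ℝ) (m : ℕ) : Monotone (gridTime t₀ m) := fun _ _ hij =>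
  mul_le_mul_left (by exact_mod_cast hij) _

lemma tendsto_mesh (ht₀ : 0 < t₀) : Tendsto (fun m : ℕ => t₀ / 2 ^ m) atTop (𝓝[>] 0) :=
  tendsto_nhdsWithin_iff.2 ⟨tendsto_const_nhds.div_atTop
    (tendsto_pow_atTop_atTop_of_one_lt one_lt_two), .of_forall fun m => mem_Ioi.2 (by positivity)⟩

lemma two_pow_mul_mesh (t₀ : ℝ) (m : ℕ) : ((2 ^ m : ℕ) : ℝ) * (t₀ / 2 ^ m) = t₀ := by
  rw [Nat.cast_pow, Nat.cast_ofNat, mul_div_cancel₀ _ (by positivity)]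

lemma natCast_mul_mesh_le (ht₀ : 0 ≤ t₀) {m i : ℕ} (hi : i ≤ 2 ^ m) :
    (i : ℝ) * (t₀ / 2 ^ m) ≤ t₀ :=
  (mul_le_mul_of_nonneg_right (Nat.cast_le.2 hi) (by positivity)).trans_eq (two_pow_mul_mesh t₀ m)

end Grid

section MartingaleBound

variable {n C : ℕ} {lam t₀ : ℝ} {Ω : Type*} [MeasurableSpace Ω] {P : Measure Ω}
  {X : ℝ≥0 → Ω → State n C}

lemma IsRoutingProcess.measureReal_grid_eq (hX : IsRoutingProcess P n C lam X) (ht₀ : 0 ≤ t₀)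
    (m : ℕ) (y : Fin (2 ^ m + 1) → State n C) :
    P.real {ω | (fun i : Fin (2 ^ m + 1) => X (gridTime t₀ m i) ω) = y} =
      P.real {ω | X (gridTime t₀ m 0) ω = y 0} *
        pathWeight (NormedSpace.exp ((t₀ / 2 ^ m) • generator n C lam)) y := by
  have hstep (i : Fin (2 ^ m)) : (gridTime t₀ m (i.succ : Fin (2 ^ m + 1)) : ℝ) -
      gridTime t₀ m (i.castSucc : Fin (2 ^ m + 1)) = t₀ / 2 ^ m := by
    rw [coe_gridTime ht₀, coe_gridTime ht₀, Fin.val_succ, Fin.val_castSucc, Nat.cast_succ]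
    ring
  have hmarkov := hX.markov (2 ^ m) (fun i => gridTime t₀ m i)
    (fun i j hij => monotone_gridTime t₀ m hij) y
  simp only [hstep] at hmarkov
  simpa only [funext_iff, pathWeight, Fin.val_zero] using hmarkov

lemma IsRoutingProcess.eventually_measureReal_exceedance_le [IsProbabilityMeasure P]
    (hX : IsRoutingProcess P n C lam X) (hlam : 0 ≤ lam) (ht₀ : 0 < t₀) {g : State n C → ℝ}
    {V ε : ℝ} (hε : 0 < ε) (hV : 0 ≤ V)
    (hg1 : ∀ x y, x ≠ y → generator n C lam x y ≠ 0 → |g y - g x| ≤ 1)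
    (hgV : ∀ x, ∑ y, generator n C lam x y * (g y - g x) ^ 2 ≤ V) (a : ℝ) :
    ∀ᶠ m : ℕ in atTop, P.real {ω | (fun i : Fin (2 ^ m + 1) => X (gridTime t₀ m i) ω) ∈
        exceedance g (fun x => t₀ / 2 ^ m * (generator n C lam).mulVec g x) a (2 ^ m)} ≤
      Real.exp (-a + t₀ * (V + ε)) := by
  filter_upwards [(tendsto_mesh ht₀).eventually
    ((isQMatrix_generator hlam).eventually_pathProb_exceedance_le hε hV hg1 hgV)] with m hm
  refine measureReal_mem_le_of_pathProb_le (fun x => hX.measurable _ x)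
    (hX.measureReal_grid_eq ht₀.le m) fun x => (hm (2 ^ m) a x).trans_eq ?_
  rw [two_pow_mul_mesh]

/-- The paths of `N` steps of length `h` along which the martingale part of the statistic `o`,
scaled by `c`, at some time reaches `b`. -/
def obsExceedance (lam h : ℝ) (N : ℕ) (c b : ℝ) (o : Observable n C) :
    Set (Fin (N + 1) → State n C) :=
  exceedance (fun x => c * obs o x.1)
    (fun x => h * (generator n C lam).mulVec (fun y => c * obs o y.1) x) b N

lemma mem_obsExceedance (hlam : 0 ≤ lam) {b c h : ℝ} {N i : ℕ} {x : ℕ → State n C}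
    {o : Observable n C} (hi : i ≤ N) (hb : b ≤ c * martingalePart lam h (obs o) x i) :
    (fun j : Fin (N + 1) => x j) ∈ obsExceedance lam h N c b o := by
  refine ⟨⟨i, Nat.lt_succ_of_le hi⟩, hb.trans_eq ?_⟩
  have hsum := Finset.sum_map (Finset.Iio (⟨i, Nat.lt_succ_of_le hi⟩ : Fin (N + 1)))
    Fin.valEmbedding fun l => h * (c * loadGen lam C (obs o) (x l).1)
  rw [Fin.map_valEmbedding_Iio, Nat.Iio_eq_range] at hsum
  rw [martingalePart, ← eulerError_const_mul, eulerError, hsum]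
  simp only [generator_mulVec hlam (fun y => c * obs o y), loadGen_const_mul, Fin.val_zero,
    Fin.valEmbedding_apply]

lemma exists_mem_obsExceedance (hlam : 0 ≤ lam) {θ h a : ℝ} (hθ : 0 ≤ θ) {N : ℕ}
    {x : ℕ → State n C} (hx : ¬ IsTypical lam h N a x) :
    ∃ o, (fun j : Fin (N + 1) => x j) ∈
      obsExceedance lam h N θ (θ * a) o ∪ obsExceedance lam h N (-θ) (θ * a) o := by
  unfold IsTypical at hx
  push Not at hx
  obtain ⟨o, i, hi, hlt⟩ := hx
  have hscale := mul_le_mul_of_nonneg_left hlt.le hθ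
  refine ⟨o, ?_⟩
  rcases abs_choice (martingalePart lam h (obs o) x i) with habs | habs <;> rw [habs] at hscale
  · exact .inl (mem_obsExceedance hlam hi hscale)
  · exact .inr (mem_obsExceedance hlam hi (hscale.trans_eq (neg_mul_comm _ _).symm))

lemma IsRoutingProcess.eventually_measureReal_obsExceedance_le [IsProbabilityMeasure P]
    (hX : IsRoutingProcess P n C lam X) (hlam : 0 ≤ lam) (ht₀ : 0 < t₀) {c ε : ℝ}
    (hc : 4 * |c| ≤ 1) (hε : 0 < ε) (b : ℝ) (o : Observable n C) :
    ∀ᶠ m : ℕ in atTop, P.real {ω | (fun i : Fin (2 ^ m + 1) => X (gridTime t₀ m i) ω) ∈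
        obsExceedance lam (t₀ / 2 ^ m) (2 ^ m) c b o} ≤
      Real.exp (-b + t₀ * (c ^ 2 * (8 * n * (2 * lam + C)) + ε)) := by
  obtain ⟨u, v, hjump⟩ := exists_jumpBound_obs o
  refine hX.eventually_measureReal_exceedance_le hlam ht₀ hε (by positivity)
    (fun x y hxy hq => ?_) (fun x => ?_) b
  · rw [← mul_sub, abs_mul]
    exact (mul_le_mul_of_nonneg_left (hjump.abs_sub_le hxy hq) (abs_nonneg c)).trans
      ((mul_comm _ _).trans_le hc)
  · simp only [← mul_sub, mul_pow, mul_left_comm _ (c ^ 2), ← Finset.mul_sum]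
    exact mul_le_mul_of_nonneg_left (hjump.sum_generator_mul_sq_le hlam x) (sq_nonneg c)

lemma IsRoutingProcess.eventually_measureReal_not_isTypical_le [IsProbabilityMeasure P]
    (hX : IsRoutingProcess P n C lam X) (hlam : 0 ≤ lam) (ht₀ : 0 < t₀) {θ ε : ℝ}
    (hθ : 0 ≤ θ) (hθ' : 4 * θ ≤ 1) (hε : 0 < ε) (a : ℝ) :
    ∀ᶠ m : ℕ in atTop,
      P.real {ω | ¬ IsTypical lam (t₀ / 2 ^ m) (2 ^ m) a fun i => X (gridTime t₀ m i) ω} ≤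
        6 * n ^ 2 * ((C : ℝ) + 1) ^ 2 *
          Real.exp (-(θ * a) + t₀ * (θ ^ 2 * (8 * n * (2 * lam + C)) + ε)) := by
  have hplus := eventually_all.2 <| hX.eventually_measureReal_obsExceedance_le hlam ht₀
    (c := θ) (by rwa [abs_of_nonneg hθ]) hε (θ * a)
  have hminus := eventually_all.2 <| hX.eventually_measureReal_obsExceedance_le hlam ht₀
    (c := -θ) (by rwa [abs_neg, abs_of_nonneg hθ]) hε (θ * a)
  filter_upwards [hplus, hminus] with m hplus hminus
  simp only [neg_sq] at hminus
  set b := Real.exp (-(θ * a) + t₀ * (θ ^ 2 * (8 * n * (2 * lam + C)) + ε))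
  let B (c : ℝ) (o : Observable n C) : Set Ω :=
    {ω | (fun i : Fin (2 ^ m + 1) => X (gridTime t₀ m i) ω) ∈
      obsExceedance lam (t₀ / 2 ^ m) (2 ^ m) c (θ * a) o}
  calc _ ≤ P.real (⋃ o, B θ o ∪ B (-θ) o) :=
        measureReal_mono fun ω hω => mem_iUnion.2 (exists_mem_obsExceedance hlam hθ hω)
    _ ≤ ∑ o, P.real (B θ o ∪ B (-θ) o) := measureReal_iUnion_fintype_le _
    _ ≤ ∑ _o : Observable n C, 2 * b := Finset.sum_le_sum fun o _ =>
        (measureReal_union_le _ _).trans ((add_le_add (hplus o) (hminus o)).trans_eq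
          (two_mul b).symm)
    _ = Fintype.card (Observable n C) * (2 * b) := by
        rw [Finset.sum_const, nsmul_eq_mul, Finset.card_univ]
    _ ≤ 3 * n ^ 2 * ((C : ℝ) + 1) ^ 2 * (2 * b) :=
        mul_le_mul_of_nonneg_right (card_observable_le n C) (by positivity)
    _ = 6 * n ^ 2 * ((C : ℝ) + 1) ^ 2 * b := by ring

end MartingaleBound

section EulerPath

variable {n C : ℕ} {lam t₀ : ℝ} {ξ₀ : Fin (C + 1) → ℝ} {ξ : ℝ → Fin (C + 1) → ℝ}

lemma IsSolution.hasDerivWithinAt_profile (h : IsSolution C lam t₀ ξ₀ ξ) {k : ℕ} (hk : k ≤ C)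
    {t : ℝ} (ht : t ∈ Icc 0 t₀) :
    HasDerivWithinAt (fun t => profile (ξ t) k)
      (linDrift lam C (share C (profile (ξ t))) (profile (ξ t)) k) (Icc 0 t₀) t := by
  have hderiv := hasDerivWithinAt_pi.1 (h.2 t ht) ⟨k, Nat.lt_succ_of_le hk⟩
  rw [drift_eq_linDrift] at hderiv
  simpa only [← profile_coe] using hderiv

lemma IsSolution.continuousOn_profile (h : IsSolution C lam t₀ ξ₀ ξ) (k : ℕ) :
    ContinuousOn (fun t => profile (ξ t) k) (Icc 0 t₀) := by
  unfold profile
  split_ifs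
  exacts [(continuous_apply _).comp_continuousOn h.continuousOn, continuousOn_const]

lemma IsSolution.continuousOn_linDrift (h : IsSolution C lam t₀ ξ₀ ξ) (k : ℕ) :
    ContinuousOn (fun t => linDrift lam C (share C (profile (ξ t))) (profile (ξ t)) k)
      (Icc 0 t₀) := by
  have hprofile := h.continuousOn_profile
  unfold linDrift share
  split_ifs <;> fun_prop

lemma eventually_natCast_mul_abs_eulerError_le (n : ℕ) (ht₀ : 0 < t₀) {ψ ψ' : ℝ → ℝ}
    (hψ : ∀ t ∈ Icc 0 t₀, HasDerivWithinAt ψ (ψ' t) (Icc 0 t₀) t)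
    (hψ' : ContinuousOn ψ' (Icc 0 t₀)) :
    ∀ᶠ m : ℕ in atTop, ∀ i ≤ 2 ^ m, n * |eulerError (t₀ / 2 ^ m)
      (fun l => ψ (l * (t₀ / 2 ^ m))) (fun l => ψ' (l * (t₀ / 2 ^ m))) i| ≤ 1 := by
  filter_upwards [(tendsto_mesh ht₀).eventually (eventually_norm_sub_euler_le
    (fun t ht => (hψ t ht).const_mul (n : ℝ)) (hψ'.const_smul (n : ℝ)) (one_div_pos.2 ht₀))]
    with m hm i hi
  have hi' := natCast_mul_mesh_le ht₀.le hi
  have hsmall := (hm i hi').trans (mul_le_mul_of_nonneg_right hi' (by positivity))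
  rw [mul_one_div_cancel ht₀.ne', Real.norm_eq_abs] at hsmall
  rw [← abs_of_nonneg (n.cast_nonneg : (0 : ℝ) ≤ n), ← abs_mul, ← eulerError_const_mul]
  simpa [eulerError] using hsmall

lemma IsSolution.eventually_isEulerPath (h : IsSolution C lam t₀ ξ₀ ξ) (ht₀ : 0 < t₀)
    (hs : ∀ t ∈ Icc 0 t₀, ξ t ∈ stdSimplex ℝ (Fin (C + 1))) (n : ℕ) :
    ∀ᶠ m : ℕ in atTop, IsEulerPath n C lam (t₀ / 2 ^ m) (2 ^ m)
      fun i => profile (ξ (i * (t₀ / 2 ^ m))) := by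
  have hsingle := (Set.finite_Iic C).eventually_all.2 fun k hk =>
    eventually_natCast_mul_abs_eulerError_le n ht₀
      (fun t ht => h.hasDerivWithinAt_profile hk ht) (h.continuousOn_linDrift k)
  have hpair := (Set.finite_Iic C).eventually_all.2 fun j hj =>
    (Set.finite_Iic C).eventually_all.2 fun k hk =>
      eventually_natCast_mul_abs_eulerError_le n ht₀
        (fun t ht => (h.hasDerivWithinAt_profile hj ht).mul (h.hasDerivWithinAt_profile hk ht))
        (((h.continuousOn_linDrift j).mul (h.continuousOn_profile k)).add
          ((h.continuousOn_profile j).mul (h.continuousOn_linDrift k)))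
  filter_upwards [hsingle, hpair] with m hsingle hpair
  exact ⟨fun i hi => isProfile_profile
    (hs _ ⟨by positivity, natCast_mul_mesh_le ht₀.le hi⟩), hsingle, hpair⟩

lemma one_add_mul_pow_le_exp {h L T : ℝ} {i : ℕ} (hh : 0 ≤ h) (hL : 0 ≤ L) (hi : i * h ≤ T) :
    (1 + h * L) ^ i ≤ Real.exp (L * T) :=
  calc (1 + h * L) ^ i ≤ Real.exp (h * L) ^ i :=
        pow_le_pow_left₀ (by positivity) ((add_comm _ _).trans_le (Real.add_one_le_exp _)) i
    _ = Real.exp (L * (i * h)) := by rw [← Real.exp_nat_mul]; ring_nf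
    _ ≤ Real.exp (L * T) := Real.exp_le_exp.2 (mul_le_mul_of_nonneg_left hi hL)

lemma IsSolution.eventually_closeTo (h : IsSolution C lam t₀ ξ₀ ξ) (hlam : 0 ≤ lam)
    (hn : 2 < n) (ht₀ : 0 < t₀) (hs : ∀ t ∈ Icc 0 t₀, ξ t ∈ stdSimplex ℝ (Fin (C + 1)))
    (a : ℝ) :
    ∀ᶠ m : ℕ in atTop, ∀ x : ℕ → State n C, IsTypical lam (t₀ / 2 ^ m) (2 ^ m) a x →
      ∀ A : ℝ, (∀ v, ∀ k ≤ C, |starCount v k (x 0).1 - ((n : ℝ) - 1) * profile ξ₀ k| ≤ A) →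
      ∀ i ≤ 2 ^ m, ∀ v, ∀ k ≤ C,
        |starCount v k (x i).1 - ((n : ℝ) - 1) * profile (ξ (i * (t₀ / 2 ^ m))) k| ≤
          (a + 2 + A + n * phi C (x 0).1 + 4 * lam * t₀) * Real.exp (growth lam C * t₀) := by
  filter_upwards [h.eventually_isEulerPath ht₀ hs n] with m hζ x hx A hA i hi v k hk
  have hmesh : 0 ≤ t₀ / 2 ^ m := by positivity
  have hinit : CloseTo C (profile (ξ ((0 : ℕ) * (t₀ / 2 ^ m)))) (A + n * phi C (x 0).1 + 1)
      (x 0).1 := by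
    refine closeTo_initial hn _ (hζ.isProfile 0 (Nat.zero_le _)) ?_
    rwa [Nat.cast_zero, zero_mul, h.1]
  have hφ : 0 ≤ n * phi C (x 0).1 := mul_nonneg n.cast_nonneg (phi_nonneg hn _)
  have hA₀ : 0 ≤ A := (abs_nonneg _).trans (hA v 0 (Nat.zero_le _))
  have ha : 0 ≤ a := (abs_nonneg _).trans (hx (.inl (v, 0)) 0 (Nat.zero_le _))
  calc _ ≤ (a + 1 + (A + n * phi C (x 0).1 + 1) + 4 * lam * t₀) *
        (1 + t₀ / 2 ^ m * growth lam C) ^ i :=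
      (hx.closeTo hlam hn hmesh (natCast_mul_mesh_le ht₀.le le_rfl) hζ hinit hi).star v k hk
    _ ≤ (a + 1 + (A + n * phi C (x 0).1 + 1) + 4 * lam * t₀) * Real.exp (growth lam C * t₀) :=
      mul_le_mul_of_nonneg_left (one_add_mul_pow_le_exp hmesh (growth_pos hlam).le
        (natCast_mul_mesh_le ht₀.le hi)) (by positivity)
    _ = _ := by ring

end EulerPath

section Numerics

variable {n C : ℕ} {lam t₀ : ℝ}

lemma two_le_add_one_div {a : ℝ} (ha : 0 < a) : 2 ≤ a + 1 / a := by
  rw [← sub_nonneg, show a + 1 / a - 2 = (a - 1) ^ 2 / a by field_simp; ring]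
  positivity

lemma two_pow_mul_sq_le (hlam : 0 < lam) (ht₀ : 0 < t₀) :
    2 ^ 24 * ((C : ℝ) + 1) ^ 2 ≤
      2 ^ 18 * (lam + 1 / lam) ^ 4 * ((C : ℝ) + 1) ^ 6 * (t₀ + 1 / t₀) ^ 2 := by
  have hlam₂ : 2 ≤ lam + 1 / lam := two_le_add_one_div hlam
  have ht₂ : 2 ≤ t₀ + 1 / t₀ := two_le_add_one_div ht₀
  have hC : 1 ≤ (C : ℝ) + 1 := le_add_of_nonneg_left C.cast_nonneg
  calc (2 : ℝ) ^ 24 * ((C : ℝ) + 1) ^ 2 = 2 ^ 18 * 2 ^ 4 * ((C : ℝ) + 1) ^ 2 * 2 ^ 2 := by ring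
    _ ≤ _ := by gcongr; norm_num

/-- The rate in the Gaussian tail of the martingale parts. -/
def tailRate (lam : ℝ) (C : ℕ) (t₀ : ℝ) : ℝ := 1 / (1 + 16 * t₀ * (2 * lam + C))

lemma tailRate_pos (hlam : 0 ≤ lam) (ht₀ : 0 ≤ t₀) : 0 < tailRate lam C t₀ := by
  unfold tailRate
  positivity

lemma tailRate_le_one (hlam : 0 ≤ lam) (ht₀ : 0 ≤ t₀) : tailRate lam C t₀ ≤ 1 := by
  unfold tailRate
  exact div_le_one_of_le₀ (le_add_of_nonneg_right (by positivity)) (by positivity)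

lemma tailRate_mul_le_one (hlam : 0 ≤ lam) (ht₀ : 0 ≤ t₀) :
    tailRate lam C t₀ * (16 * t₀ * (2 * lam + C)) ≤ 1 := by
  rw [tailRate, one_div, inv_mul_le_iff₀ (by positivity)]
  linarith

lemma gam_pos (hlam : 0 ≤ lam) (ht₀ : 0 ≤ t₀) : 0 < gam lam C t₀ := by
  unfold gam
  positivity

lemma two_mul_gam_le_tailRate (hlam : 0 < lam) (ht₀ : 0 ≤ t₀) :
    2 * gam lam C t₀ ≤ tailRate lam C t₀ := by
  have hexpand : 2 ^ 25 * (1 + C / lam) * (8 * lam * t₀ + 1) =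
      2 ^ 25 * (8 * lam * t₀ + 1 + 8 * C * t₀ + C / lam) := by
    field_simp
    ring
  have hCt : 0 ≤ C * t₀ := by positivity
  have hClam : 0 ≤ C / lam := by positivity
  have hlt : 0 ≤ lam * t₀ := by positivity
  unfold gam tailRate
  rw [mul_one_div, div_le_div_iff₀ (by positivity) (by positivity), one_mul]
  calc 2 * (1 + 16 * t₀ * (2 * lam + C)) ≤ 2 ^ 25 * (1 + C / lam) * (8 * lam * t₀ + 1) := by
        rw [hexpand]
        linarith
    _ ≤ 2 ^ 25 * (1 + C / lam) * (8 * lam * t₀ + 1) ^ 3 :=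
        mul_le_mul_of_nonneg_left (le_self_pow₀ (by linarith) three_ne_zero) (by positivity)
    _ ≤ 2 ^ 25 * (1 + C / lam) * (8 * lam * t₀ + 1) ^ 3 * Real.exp (800 * lam * t₀) :=
        le_mul_of_one_le_right (by positivity) (Real.one_le_exp (by positivity))

lemma log_le_sqrt_div_four {x : ℝ} (hx : 2 ^ 24 ≤ x) : Real.log x ≤ √x / 4 := by
  have hx₀ : 0 < x := lt_of_lt_of_le (by norm_num) hx
  obtain ⟨q, hq, rfl⟩ : ∃ q : ℝ, 0 ≤ q ∧ q ^ 4 = x :=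
    ⟨√√x, Real.sqrt_nonneg _, by
      rw [pow_mul _ 2 2, Real.sq_sqrt (Real.sqrt_nonneg x), Real.sq_sqrt hx₀.le]⟩
  have hq₆ : 2 ^ 6 ≤ q := le_of_pow_le_pow_left₀ four_ne_zero hq (by linarith)
  have hlog : Real.log q ≤ q - 1 := Real.log_le_sub_one_of_pos (by linarith)
  rw [Real.log_pow, show q ^ 4 = (q ^ 2) ^ 2 by ring, Real.sqrt_sq (sq_nonneg q)]
  push_cast
  nlinarith

lemma six_mul_sq_mul_exp_one_le (hn : 2 ^ 24 * ((C : ℝ) + 1) ^ 2 ≤ n) :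
    6 * n ^ 2 * ((C : ℝ) + 1) ^ 2 * Real.exp 1 ≤ Real.exp (3 * Real.log n) := by
  have hn₀ : (0 : ℝ) < n := lt_of_lt_of_le (by positivity) hn
  calc 6 * n ^ 2 * ((C : ℝ) + 1) ^ 2 * Real.exp 1 ≤ 6 * n ^ 2 * ((C : ℝ) + 1) ^ 2 * 3 :=
        mul_le_mul_of_nonneg_left Real.exp_one_lt_three.le (by positivity)
    _ = n ^ 2 * (18 * ((C : ℝ) + 1) ^ 2) := by ring
    _ ≤ n ^ 2 * n := mul_le_mul_of_nonneg_left (by nlinarith) (by positivity)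
    _ = Real.exp (3 * Real.log n) := by
        rw [← pow_succ, ← Real.rpow_natCast, Real.rpow_def_of_pos hn₀, mul_comm]
        norm_num

/-- The exponent that `θ = β log n / √n` with `β = tailRate` achieves at the level `√n log n`. -/
lemma exponent_le (hlam : 0 ≤ lam) (ht₀ : 0 < t₀) (hn : 0 < n) {θ : ℝ}
    (hθ : θ = tailRate lam C t₀ * Real.log n / √n) :
    -(θ * (√n * Real.log n)) + t₀ * (θ ^ 2 * (8 * n * (2 * lam + C)) + 1 / t₀) ≤
      1 - tailRate lam C t₀ / 2 * Real.log n ^ 2 := by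
  have hβ := tailRate_mul_le_one (C := C) hlam ht₀.le
  have hβ₀ := tailRate_pos (C := C) hlam ht₀.le
  set β := tailRate lam C t₀
  set ℓ := Real.log n
  have hn₀ : (0 : ℝ) < n := Nat.cast_pos.2 hn
  have hlinear : θ * (√n * ℓ) = β * ℓ ^ 2 := by
    rw [hθ]
    field_simp
  have hsq : θ ^ 2 * n = β ^ 2 * ℓ ^ 2 := by
    rw [hθ, div_pow, Real.sq_sqrt hn₀.le, div_mul_cancel₀ _ hn₀.ne', mul_pow]
  calc -(θ * (√n * ℓ)) + t₀ * (θ ^ 2 * (8 * n * (2 * lam + C)) + 1 / t₀)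
      = -(θ * (√n * ℓ)) + θ ^ 2 * n * (8 * t₀ * (2 * lam + C)) + t₀ * (1 / t₀) := by ring
    _ = 1 - β * ℓ ^ 2 + β / 2 * ℓ ^ 2 * (β * (16 * t₀ * (2 * lam + C))) := by
        rw [hlinear, hsq, mul_one_div_cancel ht₀.ne']
        ring
    _ ≤ 1 - β * ℓ ^ 2 + β / 2 * ℓ ^ 2 * 1 := by gcongr
    _ = 1 - β / 2 * ℓ ^ 2 := by ring

lemma three_mul_log_le (hlam : 0 < lam) (ht₀ : 0 ≤ t₀)
    (hn : Real.exp (8 / gam lam C t₀) ≤ n) :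
    3 * Real.log n ≤ (tailRate lam C t₀ - gam lam C t₀) / 2 * Real.log n ^ 2 := by
  have hγ := gam_pos (C := C) hlam.le ht₀
  have hβγ := two_mul_gam_le_tailRate (C := C) hlam ht₀
  have hlog : 8 / gam lam C t₀ ≤ Real.log n := by
    simpa only [Real.log_exp] using Real.log_le_log (Real.exp_pos _) hn
  have hlog₀ : 0 ≤ Real.log n := (div_pos (by norm_num) hγ).le.trans hlog
  rw [div_le_iff₀ hγ] at hlog
  nlinarith

lemma tail_le (hlam : 0 < lam) (ht₀ : 0 < t₀) (hnC : 2 ^ 24 * ((C : ℝ) + 1) ^ 2 ≤ n)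
    (hnγ : Real.exp (8 / gam lam C t₀) ≤ n) {θ : ℝ}
    (hθ : θ = tailRate lam C t₀ * Real.log n / √n) :
    6 * n ^ 2 * ((C : ℝ) + 1) ^ 2 *
      Real.exp (-(θ * (√n * Real.log n)) + t₀ * (θ ^ 2 * (8 * n * (2 * lam + C)) + 1 / t₀)) ≤
      Real.exp (-(1 / 2) * gam lam C t₀ * Real.log n ^ 2) := by
  have hn : 0 < n := by
    exact_mod_cast lt_of_lt_of_le (by positivity : (0 : ℝ) < 2 ^ 24 * ((C : ℝ) + 1) ^ 2) hnC
  set β := tailRate lam C t₀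
  set ℓ := Real.log n
  calc _ ≤ 6 * n ^ 2 * ((C : ℝ) + 1) ^ 2 * Real.exp (1 - β / 2 * ℓ ^ 2) :=
        mul_le_mul_of_nonneg_left (Real.exp_le_exp.2 (exponent_le hlam.le ht₀ hn hθ))
          (by positivity)
    _ = 6 * n ^ 2 * ((C : ℝ) + 1) ^ 2 * Real.exp 1 * Real.exp (-(β / 2 * ℓ ^ 2)) := by
        rw [sub_eq_add_neg, Real.exp_add, mul_assoc _ (Real.exp 1)]
    _ ≤ Real.exp (3 * ℓ) * Real.exp (-(β / 2 * ℓ ^ 2)) :=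
        mul_le_mul_of_nonneg_right (six_mul_sq_mul_exp_one_le hnC) (Real.exp_nonneg _)
    _ = Real.exp (3 * ℓ - β / 2 * ℓ ^ 2) := by rw [← Real.exp_add, sub_eq_add_neg]
    _ ≤ _ := Real.exp_le_exp.2 (by linarith [three_mul_log_le hlam ht₀.le hnγ])

/-- The largest deviation `|f_{u,j}(x) - (n-1) ξ₀(j)|` in the state `x`. -/
def initialError (ξ₀ : Fin (C + 1) → ℝ) (x : Route n → ℕ) : ℝ :=
  ⨆ p : Fin n × Fin (C + 1), |(numLinks x p.1 p.2 : ℝ) - ((n : ℝ) - 1) * ξ₀ p.2|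

lemma initialError_nonneg (ξ₀ : Fin (C + 1) → ℝ) (x : Route n → ℕ) : 0 ≤ initialError ξ₀ x :=
  Real.iSup_nonneg fun _ => abs_nonneg _

lemma abs_starCount_sub_le_initialError (ξ₀ : Fin (C + 1) → ℝ) (x : Route n → ℕ) (v : Fin n)
    {k : ℕ} (hk : k ≤ C) :
    |starCount v k x - ((n : ℝ) - 1) * profile ξ₀ k| ≤ initialError ξ₀ x := by
  obtain ⟨k, rfl⟩ : ∃ j : Fin (C + 1), (j : ℕ) = k := ⟨⟨k, Nat.lt_succ_of_le hk⟩, rfl⟩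
  rw [starCount_eq_numLinks, profile_coe]
  exact le_ciSup (f := fun p : Fin n × Fin (C + 1) =>
    |(numLinks x p.1 p.2 : ℝ) - ((n : ℝ) - 1) * ξ₀ p.2|) (Set.finite_range _).bddAbove (v, k)

lemma deviation_le_errorBound (hlam : 0 ≤ lam) (ht₀ : 0 ≤ t₀) (hn : 3 ≤ n)
    (ξ₀ : Fin (C + 1) → ℝ) (x : Route n → ℕ) :
    (√n * Real.log n + 2 + initialError ξ₀ x + n * phi C x + 4 * lam * t₀) *
      Real.exp (growth lam C * t₀) ≤ errorBound lam C t₀ ξ₀ x := by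
  have hA := initialError_nonneg ξ₀ x
  have hΦ : 0 ≤ n * phi C x := mul_nonneg n.cast_nonneg (phi_nonneg hn x)
  have hn₃ : (3 : ℝ) ≤ n := by exact_mod_cast hn
  have hlog : 1 ≤ Real.log n :=
    (Real.le_log_iff_exp_le (by linarith)).2 (Real.exp_one_lt_three.le.trans hn₃)
  have hW : 1 ≤ √n * Real.log n :=
    one_le_mul_of_one_le_of_one_le (Real.one_le_sqrt.2 (by linarith)) hlog
  have hlt : 0 ≤ lam * t₀ := by positivity
  have hconst : 64 * (1 + lam * t₀) ≤ 64 * (lam + 1) * (t₀ + 1) * ((C : ℝ) + 1) ^ 3 :=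
    calc 64 * (1 + lam * t₀) ≤ 64 * (lam + 1) * (t₀ + 1) := by linarith
      _ ≤ _ := le_mul_of_one_le_right (by positivity)
        (one_le_pow₀ (le_add_of_nonneg_left C.cast_nonneg))
  have hgrowth : growth lam C ≤ 216 * (lam + 1) * ((C : ℝ) + 1) := by
    have hlamC : 0 ≤ lam * C := by positivity
    unfold growth
    linarith
  unfold errorBound
  rw [mul_assoc 3, ← Real.sqrt_eq_rpow]
  change _ ≤ (initialError ξ₀ x + _) * _
  set W := √n * Real.log n
  set A := initialError ξ₀ x
  set Φ := n * phi C x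
  have hsum : W + 2 + A + Φ + 4 * lam * t₀ ≤
      A + 64 * (lam + 1) * (t₀ + 1) * ((C : ℝ) + 1) ^ 3 * (Φ + 3 * W) := by
    have hscale := mul_le_mul_of_nonneg_right hconst (show 0 ≤ Φ + 3 * W by linarith)
    have hltW : lam * t₀ ≤ lam * t₀ * W := le_mul_of_one_le_right hlt hW
    have hltΦ : 0 ≤ lam * t₀ * Φ := mul_nonneg hlt hΦ
    linarith
  exact mul_le_mul hsum (Real.exp_le_exp.2 (mul_le_mul_of_nonneg_right hgrowth ht₀))
    (Real.exp_nonneg _) (by positivity)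

end Numerics

section Approximation

variable {n C : ℕ} {lam t₀ : ℝ}

lemma exists_tendsto_gridTime (ht₀ : 0 < t₀) {t : ℝ≥0} (ht : t ≤ t₀) :
    ∃ i : ℕ → ℕ, (∀ m, i m ≤ 2 ^ m) ∧
      Tendsto (fun m => gridTime t₀ m (i m)) atTop (𝓝[≥] t) := by
  have hcancel (m : ℕ) : (t : ℝ) / (t₀ / 2 ^ m) * (t₀ / 2 ^ m) = t :=
    div_mul_cancel₀ _ (by positivity)
  have hlower (m : ℕ) : (t : ℝ) ≤ gridTime t₀ m ⌈(t : ℝ) / (t₀ / 2 ^ m)⌉₊ := by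
    rw [coe_gridTime ht₀.le]
    exact (hcancel m).symm.trans_le (mul_le_mul_of_nonneg_right (Nat.le_ceil _) (by positivity))
  have hupper (m : ℕ) : (gridTime t₀ m ⌈(t : ℝ) / (t₀ / 2 ^ m)⌉₊ : ℝ) ≤ t + t₀ / 2 ^ m := by
    rw [coe_gridTime ht₀.le]
    refine (mul_le_mul_of_nonneg_right (Nat.ceil_lt_add_one (by positivity)).le
      (by positivity)).trans_eq ?_
    rw [add_mul, hcancel, one_mul]
  refine ⟨fun m => ⌈(t : ℝ) / (t₀ / 2 ^ m)⌉₊, fun m => Nat.ceil_le.2 ?_,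
    tendsto_nhdsWithin_iff.2 ⟨NNReal.tendsto_coe.1 ?_, .of_forall hlower⟩⟩
  · rwa [div_le_iff₀ (by positivity), two_pow_mul_mesh]
  · refine tendsto_of_tendsto_of_tendsto_of_le_of_le tendsto_const_nhds ?_ hlower hupper
    simpa only [add_zero] using
      ((tendsto_mesh ht₀).mono_right nhdsWithin_le_nhds).const_add (t : ℝ)

lemma measure_le_of_ae_eventually {Ω : Type*} [MeasurableSpace Ω] {P : Measure Ω}
    {D : Set Ω} {B : ℕ → Set Ω} {b : ℝ≥0∞} (hB : ∀ᶠ m in atTop, P (B m) ≤ b)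
    (hD : ∀ᵐ ω ∂P, ω ∈ D → ∀ᶠ m in atTop, ω ∈ B m) : P D ≤ b := by
  obtain ⟨M₀, hM₀⟩ := eventually_atTop.1 hB
  have hmono : Monotone fun M => ⋂ m ≥ M, B m := fun M M' hMM' =>
    biInter_subset_biInter_left fun m (hm : M' ≤ m) => hMM'.trans hm
  calc P D ≤ P (⋃ M, ⋂ m ≥ M, B m) := by
        refine measure_mono_ae ?_
        filter_upwards [hD] with ω hω hωD
        obtain ⟨M, hM⟩ := eventually_atTop.1 (hω hωD)
        exact mem_iUnion.2 ⟨M, mem_iInter₂.2 hM⟩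
    _ = ⨆ M, P (⋂ m ≥ M, B m) := hmono.measure_iUnion
    _ ≤ b := iSup_le fun M => (measure_mono (biInter_subset_of_mem (le_max_left M M₀))).trans
        (hM₀ _ (le_max_right M M₀))

lemma IsSolution.eventually_not_isTypical {ξ₀ : Fin (C + 1) → ℝ} {ξ : ℝ → Fin (C + 1) → ℝ}
    (h : IsSolution C lam t₀ ξ₀ ξ) (hlam : 0 ≤ lam) (hn : 2 < n) (ht₀ : 0 < t₀)
    (hs : ∀ t ∈ Icc 0 t₀, ξ t ∈ stdSimplex ℝ (Fin (C + 1))) {x : ℝ≥0 → State n C}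
    (hx : ∀ t, ∀ᶠ s in 𝓝[≥] t, x s = x t) {v : Fin n} {k : Fin (C + 1)} {t : ℝ≥0} (ht : t ≤ t₀)
    (hdev : errorBound lam C t₀ ξ₀ (x 0).1 <
      |(numLinks (x t).1 v k : ℝ) - ((n : ℝ) - 1) * ξ t k|) :
    ∀ᶠ m : ℕ in atTop, ¬ IsTypical lam (t₀ / 2 ^ m) (2 ^ m) (√n * Real.log n)
      fun i => x (gridTime t₀ m i) := by
  obtain ⟨i, hi, hlim⟩ := exists_tendsto_gridTime ht₀ ht
  have hmem (m : ℕ) : (gridTime t₀ m (i m) : ℝ) ∈ Icc 0 t₀ :=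
    ⟨NNReal.coe_nonneg _, (coe_gridTime ht₀.le m _).trans_le (natCast_mul_mesh_le ht₀.le (hi m))⟩
  have hξlim : Tendsto (fun m => ξ (gridTime t₀ m (i m)) k) atTop (𝓝 (ξ t k)) :=
    (((continuous_apply k).comp_continuousOn h.continuousOn) t ⟨t.2, ht⟩).tendsto.comp
      (tendsto_nhdsWithin_iff.2 ⟨NNReal.tendsto_coe.2 (hlim.mono_right nhdsWithin_le_nhds),
        .of_forall hmem⟩)
  have hgrid := (tendsto_const_nhds.sub (hξlim.const_mul ((n : ℝ) - 1))).abs.eventually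
    (lt_mem_nhds hdev)
  filter_upwards [hlim.eventually (hx t), hgrid,
    h.eventually_closeTo hlam hn ht₀ hs (√n * Real.log n)] with m hconst hdev hclose htypical
  have hbound := hclose _ htypical (initialError ξ₀ (x 0).1)
    (fun v k hk => gridTime_zero t₀ m ▸ abs_starCount_sub_le_initialError ξ₀ _ v hk)
    (i m) (hi m) v k (Nat.le_of_lt_succ k.2)
  rw [starCount_eq_numLinks, profile_coe, ← coe_gridTime ht₀.le, hconst, gridTime_zero] at hbound
  exact hdev.not_ge (hbound.trans (deviation_le_errorBound hlam ht₀.le hn ξ₀ _))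

lemma IsRoutingProcess.eventually_measure_not_isTypical_le {Ω : Type*} [MeasurableSpace Ω]
    {P : Measure Ω} [IsProbabilityMeasure P] {X : ℝ≥0 → Ω → State n C}
    (hX : IsRoutingProcess P n C lam X) (hlam : 0 < lam) (ht₀ : 0 < t₀)
    (hnC : 2 ^ 24 * ((C : ℝ) + 1) ^ 2 ≤ n) (hnγ : Real.exp (8 / gam lam C t₀) ≤ n) :
    ∀ᶠ m : ℕ in atTop, P {ω | ¬ IsTypical lam (t₀ / 2 ^ m) (2 ^ m) (√n * Real.log n)
        fun i => X (gridTime t₀ m i) ω} ≤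
      ENNReal.ofReal (Real.exp (-(1 / 2) * gam lam C t₀ * Real.log n ^ 2)) := by
  have hn : (2 : ℝ) ^ 24 ≤ n := (le_mul_of_one_le_right (by positivity)
    (one_le_pow₀ (le_add_of_nonneg_left C.cast_nonneg))).trans hnC
  have hlog : 0 ≤ Real.log n := Real.log_natCast_nonneg n
  obtain ⟨θ, hθ⟩ : ∃ θ, θ = tailRate lam C t₀ * Real.log n / √n := ⟨_, rfl⟩
  have hθ₀ : 0 ≤ θ := by
    rw [hθ]
    exact div_nonneg (mul_nonneg (tailRate_pos hlam.le ht₀.le).le hlog) (Real.sqrt_nonneg _)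
  have hθ₄ : 4 * θ ≤ 1 := by
    rw [hθ, mul_div_assoc']
    refine div_le_one_of_le₀ ?_ (Real.sqrt_nonneg _)
    linarith [log_le_sqrt_div_four hn,
      mul_le_of_le_one_left hlog (tailRate_le_one (C := C) hlam.le ht₀.le)]
  filter_upwards [hX.eventually_measureReal_not_isTypical_le hlam.le ht₀ hθ₀ hθ₄
    (one_div_pos.2 ht₀) (√n * Real.log n)] with m hm
  rw [← ofReal_measureReal (measure_ne_top _ _)]
  exact ENNReal.ofReal_le_ofReal (hm.trans (tail_le hlam ht₀ hnC hnγ hθ))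

end Approximation

end

end Routing

theorem theorem1p2_general {Ω : Type*} [MeasurableSpace Ω] (P : Measure Ω)
    [IsProbabilityMeasure P] (lam t₀ : ℝ) (hlam : 0 < lam) (ht₀ : 0 < t₀) (C n : ℕ)
    (hn : max (2 ^ 18 * (lam + 1 / lam) ^ 4 * ((C : ℝ) + 1) ^ 6 * (t₀ + 1 / t₀) ^ 2)
      (Real.exp (8 / Routing.gam lam C t₀)) ≤ (n : ℝ))
    (ξ₀ : Fin (C + 1) → ℝ) (hξ₀ : ξ₀ ∈ stdSimplex ℝ (Fin (C + 1)))
    (X : ℝ≥0 → Ω → Routing.State n C) (hX : Routing.IsRoutingProcess P n C lam X) :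
    ∃ ξ : ℝ → Fin (C + 1) → ℝ,
      Routing.IsSolution C lam t₀ ξ₀ ξ ∧
      (∀ η : ℝ → Fin (C + 1) → ℝ, Routing.IsSolution C lam t₀ ξ₀ η → EqOn η ξ (Icc 0 t₀)) ∧
      P {ω | ¬ ∀ (v : Fin n) (k : Fin (C + 1)) (t : ℝ≥0), (t : ℝ) ≤ t₀ →
          |(Routing.numLinks (X t ω).1 v k : ℝ) - ((n : ℝ) - 1) * ξ t k| ≤
            Routing.errorBound lam C t₀ ξ₀ (X 0 ω).1} ≤
        ENNReal.ofReal (Real.exp (-(1 / 2) * Routing.gam lam C t₀ * Real.log n ^ 2)) := by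
  open Routing in
  obtain ⟨hnC, hnγ⟩ := max_le_iff.1 hn
  replace hnC := (two_pow_mul_sq_le hlam ht₀).trans hnC
  have hn₂ : 2 < n := by
    have hC : (1 : ℝ) ≤ ((C : ℝ) + 1) ^ 2 := one_le_pow₀ (le_add_of_nonneg_left C.cast_nonneg)
    exact_mod_cast show (2 : ℝ) < n by linarith
  obtain ⟨ξ, hξ, hs⟩ := exists_isSolution hlam.le ht₀.le hξ₀
  refine ⟨ξ, hξ, fun η hη => hη.eqOn hξ, measure_le_of_ae_eventually
    (hX.eventually_measure_not_isTypical_le hlam ht₀ hnC hnγ) ?_⟩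
  filter_upwards [hX.right_continuous] with ω hω hdev
  simp only [not_forall, not_le] at hdev
  obtain ⟨v, k, t, ht, hdev⟩ := hdev
  exact hξ.eventually_not_isTypical hlam.le hn₂ ht₀ hs hω ht hdev

theorem theorem1p2 {Ω : Type*} [MeasurableSpace Ω] (P : Measure Ω) [IsProbabilityMeasure P]
    (lam t₀ : ℝ) (hlam : 0 < lam) (ht₀ : 0 < t₀) (C : ℕ) (hC : 1 ≤ C) (n : ℕ)
    (hn : max (2 ^ 18 * (lam + 1 / lam) ^ 4 * ((C : ℝ) + 1) ^ 6 * (t₀ + 1 / t₀) ^ 2)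
      (Real.exp (8 / Routing.gam lam C t₀)) ≤ (n : ℝ))
    (ξ₀ : Fin (C + 1) → ℝ) (hξ₀ : ξ₀ ∈ stdSimplex ℝ (Fin (C + 1)))
    (X : ℝ≥0 → Ω → Routing.State n C) (hX : Routing.IsRoutingProcess P n C lam X)
    (hX₀ : ∀ᵐ ω ∂P, ((∑ r, (X 0 ω).1 r : ℕ) : ℝ) ≤ 2 * lam * (n.choose 2 : ℝ)) :
    ∃ ξ : ℝ → Fin (C + 1) → ℝ,
      Routing.IsSolution C lam t₀ ξ₀ ξ ∧
      (∀ η : ℝ → Fin (C + 1) → ℝ, Routing.IsSolution C lam t₀ ξ₀ η → EqOn η ξ (Icc 0 t₀)) ∧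
      P {ω | ¬ ∀ (v : Fin n) (k : Fin (C + 1)) (t : ℝ≥0), (t : ℝ) ≤ t₀ →
          |(Routing.numLinks (X t ω).1 v k : ℝ) - ((n : ℝ) - 1) * ξ t k| ≤
            Routing.errorBound lam C t₀ ξ₀ (X 0 ω).1} ≤
        ENNReal.ofReal (Real.exp (-(1 / 2) * Routing.gam lam C t₀ * Real.log n ^ 2)) :=
  theorem1p2_general P lam t₀ hlam ht₀ C n hn ξ₀ hξ₀ X hX
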